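/- Let $D$ be a diagram of an unoriented (framed) link with $N$ crossings. For a Kauffman state $s$ (a choice of marker $\pm1$ at each crossing) let $D_s$ be the system of circles obtained by smoothing $D$ according to $s$, let $|s|$ be the number of these circles, and let $G_s(D)$ be the graph whose vertices are the circles of $D_s$ and whose edges are the crossings of $D$, each joining the circles it connects. Let $s_+$, $s_-$ be the states with all markers positive, respectively negative. $D$ is $\pm$-adequate if $G_{s_\pm}(D)$ has no loops, and strongly $\pm$-adequate if $G_{s_\pm}(D)$ has girth (length of the shortest cycle, $\infty$ for a forest) greater than $2$. For a graph $G$ let $p_0(G)$ be the number of its components, $p_0^{bi}(G)$ the number of its bipartite components, and $p_1(G)=|E|-|V|+p_0(G)$. Let $C_{a,b}(D)$ be the free abelian group on enhanced Kauffman states $S$ (a state $s$ with a sign on each circle of $D_s$) with $a=\sigma(s)$ and $b=\sigma(s)+2\tau(S)$, where $\sigma$ is the number of positive minus the number of negative markers and $\tau$ the number of positive minus the number of negative circles. Let $H_{a,b}(D)$ be the (framed) Khovanov homology, the homology of $C_{a+2,b}\to C_{a,b}\to C_{a-2,b}$, and let $H^{a,b}(D)$ be the Khovanov cohomology, the cohomology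 of the dual complex $\mathrm{Hom}(C_{*,b}(D),\mathbb Z)$ at $a$. (i) If $D$ is $+$-adequate, then $\mathrm{tor}\,H_{N-2,\,N+2|s_+|-4}(D)\cong \mathbb Z_2^{\,p_0-p_0^{bi}}$, where $p_0=p_0(G_{s_+}(D))$ and $p_0^{bi}=p_0^{bi}(G_{s_+}(D))$. (ii) If $D$ is strongly $+$-adequate, then $H_{N-2,\,N+2|s_+|-4}(D)\cong \mathbb Z_2^{\,p_0-p_0^{bi}}\oplus\mathbb Z^{\,p_1-(p_0-p_0^{bi})}$ with $p_0,p_0^{bi},p_1$ those of $G_{s_+}(D)$. (iii) If $D$ is $-$-adequate, then $\mathrm{tor}\,H^{-N+2,\,-N-2|s_-|+4}(D)\cong \mathbb Z_2^{\,p_0-p_0^{bi}}$, where $p_0=p_0(G_{s_-}(D))$ and $p_0^{bi}=p_0^{bi}(G_{s_-}(D))$. (iv) If $D$ is strongly $-$-adequate, then $H^{-N+2,\,-N-2|s_-|+4}(D)\cong \mathbb Z_2^{\,p_0-p_0^{bi}}\oplus\mathbb Z^{\,p_1-(p_0-p_0^{bi})}$ with $p_0,p_0^{bi},p_1$ those of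 $G_{s_-}(D)$. -/

import Mathlib

namespace Graph

/-- Connected components of a multigraph. -/
def Component {α β : Type*} (G : Graph α β) : Type _ :=
  Quot (fun x y : G.vertexSet => G.Adj x y)

/-- A component is bipartite if its vertices can be coloured by two colours so that
the two ends of each of its edges have different colours. -/
def Component.IsBipartite {α β : Type*} {G : Graph α β} (C : G.Component) : Prop :=
  ∃ f : G.vertexSet → Bool, ∀ x y : G.vertexSet,
    G.Adj x y → (Quot.mk _ x : G.Component) = C → f x ≠ f y

/-- `p₀(G)`: the number of components. -/
noncomputable def numComponents {α β : Type*} (G : Graph α β) : ℕ :=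
  Nat.card G.Component

/-- `p₀^{bi}(G)`: the number of bipartite components. -/
noncomputable def numBipartiteComponents {α β : Type*} (G : Graph α β) : ℕ :=
  Nat.card {C : G.Component // C.IsBipartite}

/-- `p₁(G) = |E| - |V| + p₀`: the cyclomatic number. -/
noncomputable def cyclomaticNumber {α β : Type*} (G : Graph α β) : ℤ :=
  (G.edgeSet.ncard : ℤ) - G.vertexSet.ncard + G.numComponents

/-- `G` has a cycle of length `n ≥ 1`: `n` distinct vertices, arranged cyclically, with
consecutive ones joined by `n` distinct edges. A loop is a cycle of length one; two
different edges with the same pair of distinct ends form a cycle of length two. -/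
def HasCycleOfLength {α β : Type*} (G : Graph α β) (n : ℕ) : Prop :=
  0 < n ∧ ∃ (v : ZMod n → α) (e : ZMod n → β),
    Function.Injective v ∧ Function.Injective e ∧ ∀ i, G.IsLink (e i) (v i) (v (i + 1))

/-- The girth: the length of the shortest cycle (`⊤` if there is no cycle). -/
noncomputable def cycleGirth {α β : Type*} (G : Graph α β) : ℕ∞ :=
  ⨅ n ∈ {n : ℕ | G.HasCycleOfLength n}, (n : ℕ∞)

end Graph

/-- A combinatorial (planar diagram code) description of an unoriented link diagram.
The diagram has `N` crossings. The four ends at crossing `c` are `(c, 0), …, (c, 3)`, numbered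
counterclockwise so that `(c, 0), (c, 2)` are the ends of the underpass and
`(c, 1), (c, 3)` those of the overpass. `glue` pairs the two ends of each arc running
from a crossing to a crossing, and there are `numFree` further closed components without crossings.
The diagram lies in the plane: the underlying 4-valent graph, with the given cyclic orders at the
crossings, has genus zero, that is `V - E + F = 2 * (number of connected pieces)`, where
`E = 2 * N` and the faces are the orbits of "follow an arc, then turn to the next end". -/
structure LinkDiagram where
  N : ℕ
  glue : Fin N × Fin 4 → Fin N × Fin 4
  glue_glue : ∀ d, glue (glue d) = d
  glue_ne : ∀ d, glue d ≠ d
  numFree : ℕ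
  planar : (N : ℤ) - 2 * N
      + Nat.card (Quot (fun d d' : Fin N × Fin 4 => d' = ((glue d).1, (glue d).2 + 1)))
    = 2 * Nat.card (Quot (fun d d' : Fin N × Fin 4 => d' = glue d ∨ d' = (d.1, d.2 + 1)))

namespace LinkDiagram

variable (D : LinkDiagram)

/-- A Kauffman state: a marker `±1` at each crossing. -/
abbrev KState : Type := Fin D.N → ℤˣ

/-- The state `s₊` with all markers positive. -/
def plusState : D.KState := fun _ => 1

/-- The state `s₋` with all markers negative. -/
def minusState : D.KState := fun _ => -1

/-- The pieces the circles of a smoothing are made of: ends of arcs at crossings, and the closed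
components without crossings. -/
abbrev Piece : Type := (Fin D.N × Fin 4) ⊕ Fin D.numFree

/-- How the four ends at a crossing are joined by the smoothing. The positive marker merges the two
regions swept out when the overpass `1, 3` is rotated counterclockwise towards the underpass
(those between ends `1, 2` and between ends `3, 0`), so it joins `0` to `1` and `2` to `3`.
The negative marker joins `0` to `3` and `1` to `2`. -/
def smoothEnd (m : ℤˣ) : Fin 4 → Fin 4 :=
  if m = 1 then ![1, 0, 3, 2] else ![3, 2, 1, 0]

/-- Two pieces are adjacent on a circle of `D_s` if they are the two ends of an arc, or if they are
joined by the smoothing of a crossing. -/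
inductive Step (s : D.KState) : D.Piece → D.Piece → Prop
  | arc (d : Fin D.N × Fin 4) : Step s (Sum.inl d) (Sum.inl (D.glue d))
  | smooth (c : Fin D.N) (i : Fin 4) :
      Step s (Sum.inl (c, i)) (Sum.inl (c, smoothEnd (s c) i))

/-- The circles of the smoothed diagram `D_s`. -/
def Circle (s : D.KState) : Type := Quot (D.Step s)

instance (s : D.KState) : Finite (D.Circle s) :=
  Finite.of_surjective (Quot.mk (D.Step s)) Quot.mk_surjective

noncomputable instance (s : D.KState) : Fintype (D.Circle s) := Fintype.ofFinite _

/-- The circle of `D_s` on which a piece lies. -/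
def circleOf (s : D.KState) (x : D.Piece) : D.Circle s := Quot.mk _ x

/-- `|s|`: the number of circles of `D_s`. -/
noncomputable def numCircles (s : D.KState) : ℕ := Nat.card (D.Circle s)

/-- The graph `G_s(D)`: its vertices are the circles of `D_s`, its edges the crossings of `D`; the
edge of `c` joins the circles that run along the two strands into which `c` is smoothed.
For either marker the ends `0` and `2` lie on different strands. -/
def stateGraph (s : D.KState) : Graph (D.Circle s) (Fin D.N) where
  vertexSet := Set.univ
  edgeSet := Set.univ
  IsLink c x y :=
    (x = D.circleOf s (Sum.inl (c, 0)) ∧ y = D.circleOf s (Sum.inl (c, 2))) ∨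
    (x = D.circleOf s (Sum.inl (c, 2)) ∧ y = D.circleOf s (Sum.inl (c, 0)))
  isLink_symm c _ := ⟨fun x y h => by tauto⟩
  eq_or_eq_of_isLink_of_isLink := by
    rintro e x y v w (⟨rfl, rfl⟩ | ⟨rfl, rfl⟩) (⟨rfl, rfl⟩ | ⟨rfl, rfl⟩) <;> simp
  edge_mem_iff_exists_isLink c := ⟨fun _ => ⟨_, _, Or.inl ⟨rfl, rfl⟩⟩, fun _ => trivial⟩
  left_mem_of_isLink _ _ _ _ := trivial

/-- `G_{s₊}(D)`. -/
abbrev plusGraph : Graph (D.Circle D.plusState) (Fin D.N) := D.stateGraph D.plusState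

/-- `G_{s₋}(D)`. -/
abbrev minusGraph : Graph (D.Circle D.minusState) (Fin D.N) := D.stateGraph D.minusState

/-- `D` is `+`-adequate: `G_{s₊}(D)` has no loops. -/
def IsPlusAdequate : Prop := D.plusGraph.Loopless

/-- `D` is `-`-adequate: `G_{s₋}(D)` has no loops. -/
def IsMinusAdequate : Prop := D.minusGraph.Loopless

/-- `D` is strongly `+`-adequate: `G_{s₊}(D)` has girth greater than two. -/
def IsStronglyPlusAdequate : Prop := 2 < D.plusGraph.cycleGirth

/-- `D` is strongly `-`-adequate: `G_{s₋}(D)` has girth greater than two. -/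
def IsStronglyMinusAdequate : Prop := 2 < D.minusGraph.cycleGirth

/-- An enhanced Kauffman state: a Kauffman state with a sign on each circle of `D_s`. -/
structure EnhancedState where
  state : D.KState
  sign : D.Circle state → ℤˣ

instance : Finite D.EnhancedState :=
  Finite.of_injective
    (fun S : D.EnhancedState =>
      (⟨S.state, S.sign⟩ : Σ s : D.KState, (D.Circle s → ℤˣ)))
    (by rintro ⟨s, e⟩ ⟨s', e'⟩ h; cases h; rfl)

variable {D}

/-- `σ(S)`: the number of positive markers minus the number of negative markers. -/
def EnhancedState.sigma (S : D.EnhancedState) : ℤ := ∑ c, (S.state c : ℤ)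

/-- `τ(S)`: the number of positive circles minus the number of negative circles. -/
noncomputable def EnhancedState.tau (S : D.EnhancedState) : ℤ := ∑ x, (S.sign x : ℤ)

/-- `S'` is obtained from `S` by changing the marker of the crossing `c` from `+` to `-`, keeping
the signs of all circles that do not pass through `c`, in such a way that `τ(S') = τ(S) + 1`. -/
def EnhancedState.Changes (S S' : D.EnhancedState) (c : Fin D.N) : Prop :=
  S.state c = 1 ∧ S'.state = Function.update S.state c (-1) ∧
  (∀ x : D.Piece,
    (∀ i : Fin 4, D.circleOf S.state (Sum.inl (c, i)) ≠ D.circleOf S.state x) →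
      S'.sign (D.circleOf S'.state x) = S.sign (D.circleOf S.state x)) ∧
  S'.tau = S.tau + 1

open Classical in
/-- The incidence number `[S : S']`. It is `(-1)^t` if `S'` is obtained from `S` by an admissible
change at a (necessarily unique) crossing `c`, where `t` is the number of negative markers of `S` at
crossings after `c`, and it is `0` otherwise. -/
noncomputable def EnhancedState.incidence (S S' : D.EnhancedState) : ℤ :=
  ∑ c : Fin D.N, if S.Changes S' c then
    (-1) ^ (Finset.univ.filter (fun c' => c < c' ∧ S.state c' = -1)).card else 0

variable (D)

/-- The enhanced states of bidegree `(a, b)`: `a = σ(S)` and `b = σ(S) + 2 τ(S)`. They are the basis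
of the chain group `C_{a,b}(D)`. -/
def Gen (a b : ℤ) : Type :=
  {S : D.EnhancedState // S.sigma = a ∧ S.sigma + 2 * S.tau = b}

instance (a b : ℤ) : Finite (D.Gen a b) :=
  inferInstanceAs (Finite {S : D.EnhancedState // S.sigma = a ∧ S.sigma + 2 * S.tau = b})

noncomputable instance (a b : ℤ) : Fintype (D.Gen a b) := Fintype.ofFinite _

/-- The matrix of incidence numbers between the generators of bidegrees `(a, b)` and `(a', b)`. -/
noncomputable def incMatrix (a a' b : ℤ) : Matrix (D.Gen a' b) (D.Gen a b) ℤ :=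
  Matrix.of fun S' S => S.1.incidence S'.1

/-- The boundary map `C_{a,b}(D) → C_{a',b}(D)`, `S ↦ ∑_{S'} [S : S'] S'`, of Khovanov's chain
complex of an unoriented framed link diagram; it is used for `a' = a - 2`. -/
noncomputable def boundary (a a' b : ℤ) : (D.Gen a b → ℤ) →ₗ[ℤ] (D.Gen a' b → ℤ) :=
  (D.incMatrix a a' b).mulVecLin

/-- The coboundary map `C^{a',b}(D) → C^{a,b}(D)`, the dual of `boundary`, where
`C^{a,b}(D) = Hom(C_{a,b}(D), ℤ)` is written in the dual basis. -/
noncomputable def coboundary (a a' b : ℤ) : (D.Gen a' b → ℤ) →ₗ[ℤ] (D.Gen a b → ℤ) :=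
  (D.incMatrix a a' b).transpose.mulVecLin

/-- The Khovanov homology group `H_{a,b}(D)` of the unoriented framed link diagram `D`: the homology
of `C_{a+2,b}(D) → C_{a,b}(D) → C_{a-2,b}(D)` at the middle. -/
abbrev Homology (a b : ℤ) : Type :=
  (LinearMap.ker (D.boundary a (a - 2) b)) ⧸
    (LinearMap.range (D.boundary (a + 2) a b)).submoduleOf
      (LinearMap.ker (D.boundary a (a - 2) b))

/-- The Khovanov cohomology group `H^{a,b}(D)`: the cohomology of
`C^{a-2,b}(D) → C^{a,b}(D) → C^{a+2,b}(D)` at the middle. -/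
abbrev Cohomology (a b : ℤ) : Type :=
  (LinearMap.ker (D.coboundary (a + 2) a b)) ⧸
    (LinearMap.range (D.coboundary a (a - 2) b)).submoduleOf
      (LinearMap.ker (D.coboundary (a + 2) a b))

end LinkDiagram

/-! ### Torsion and splitting of abelian groups. -/

section AbelianGroups

/-! Fix `η = ±1` and the second extremal degree `b`. An enhanced state with `j` markers different
from `η` carries `(|s| - |s_η| + 2 - j) / 2` circle signs different from `η` (`isLevel_mk_iff`). For
`j = 0` exactly one circle has the wrong sign, so the generators are the vertices of the state
graph. For `j = 1` adequacy makes the flipped crossing merge two circles, so no sign is wrong and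
the generators are the edges. For `j = 2` the second flip must split a circle again, which forces
the two crossings to be parallel edges (`exists_parallel`).

The incidence number of a vertex and an edge is `±1` exactly when they are incident, with a sign
depending on the edge only (`directedIncidence_vertexGen_edgeGen`). Up to signs of the basis, the
first differential is therefore the signless incidence map `M : f ↦ (e ↦ f (l e) + f (r e))`. The
next group is torsion-free, so the torsion of the homology is that of coker `M`; under strong
adequacy there are no parallel edges, the next group vanishes and the homology is all of coker `M`.

The kernel of `M` consists of functions alternating in sign along edges, so it has one generator per
bipartite component, and coker `M` has rank `|E| - |V| + p₀^{bi} = p₁ - (p₀ - p₀^{bi})`. Each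
non-bipartite component contributes one `ℤ/2` of torsion, generated by the function equal to 1 on
its edges: this is half the image of the constant 1 on its vertices
(`nonempty_torsion_coker_equiv`).

The case `η = -1` is dual: transposing the incidence matrices reverses the direction of the flips,
and `directedIncidence` treats both cases at once. -/

theorem AddCommGroup.mem_torsion_iff_exists_nsmul {A : Type*} [AddCommGroup A] {x : A} :
    x ∈ AddCommGroup.torsion A ↔ ∃ n : ℕ, 0 < n ∧ n • x = 0 :=
  isOfFinAddOrder_iff_nsmul_eq_zero

/-- A homomorphism which is injective and whose image contains the torsion induces an isomorphism
of torsion subgroups. -/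
theorem AddCommGroup.nonempty_torsion_equiv {A B : Type*} [AddCommGroup A] [AddCommGroup B]
    (f : A →+ B) (hf : Function.Injective f)
    (hB : ∀ y ∈ AddCommGroup.torsion B, ∃ x, f x = y) :
    Nonempty (AddCommGroup.torsion A ≃+ AddCommGroup.torsion B) := by
  have key : ∀ x, x ∈ AddCommGroup.torsion A ↔ f x ∈ AddCommGroup.torsion B := fun x => by
    simp only [mem_torsion_iff_exists_nsmul, ← map_nsmul, map_eq_zero_iff f hf]
  refine ⟨AddEquiv.ofBijective
    ((f.comp (AddCommGroup.torsion A).subtype).codRestrict (AddCommGroup.torsion B)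
      fun x => (key _).1 x.2) ⟨fun x y h => ?_, fun y => ?_⟩⟩
  · exact Subtype.ext (hf (congrArg Subtype.val h))
  · obtain ⟨x, hx⟩ := hB y y.2
    exact ⟨⟨x, (key x).2 (hx ▸ y.2)⟩, Subtype.ext hx⟩

/-- A finitely generated abelian group is the product of its torsion subgroup and a free group. -/
theorem AddCommGroup.nonempty_equiv_torsion_prod (A : Type*) [AddCommGroup A] [Module.Finite ℤ A] :
    Nonempty (A ≃+ AddCommGroup.torsion A × (Fin (Module.finrank ℤ A) → ℤ)) := by
  let T := Submodule.torsion ℤ A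
  have : Module.Free ℤ (A ⧸ T) := inferInstance
  obtain ⟨l, hl⟩ := Module.projective_lifting_property T.mkQ LinearMap.id T.mkQ_surjective
  obtain ⟨e, -⟩ := (LinearMap.exact_subtype_mkQ T).splitSurjectiveEquiv T.injective_subtype ⟨l, hl⟩
  have hr : Module.finrank ℤ (A ⧸ T) = Module.finrank ℤ A :=
    finrank_quotient_eq_of_le_torsion le_rfl
  let b : (A ⧸ T) ≃ₗ[ℤ] (Fin (Module.finrank ℤ A) → ℤ) :=
    (Module.finBasisOfFinrankEq ℤ (A ⧸ T) hr).equivFun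
  have hT : ∀ x, x ∈ T ↔ x ∈ AddCommGroup.torsion A := fun x => by
    rw [← Submodule.torsion_int]; rfl
  let t : T ≃+ AddCommGroup.torsion A :=
    { toFun := fun x => ⟨x, (hT x).1 x.2⟩
      invFun := fun x => ⟨x, (hT x).2 x.2⟩
      map_add' := fun _ _ => rfl }
  exact ⟨e.toAddEquiv.trans (AddEquiv.prodCongr t b.toAddEquiv)⟩

/-- Two surjections with the same kernel have isomorphic targets. -/
theorem AddMonoidHom.nonempty_equiv_of_ker_eq {A B C : Type*} [AddCommGroup A] [AddCommGroup B]
    [AddCommGroup C] (f : A →+ B) (g : A →+ C) (hf : Function.Surjective f)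
    (hg : Function.Surjective g) (h : ∀ x, f x = 0 ↔ g x = 0) : Nonempty (B ≃+ C) :=
  ⟨(QuotientAddGroup.quotientKerEquivOfSurjective f hf).symm.trans
    ((QuotientAddGroup.quotientAddEquivOfEq (by ext x; exact h x)).trans
      (QuotientAddGroup.quotientKerEquivOfSurjective g hg))⟩

end AbelianGroups

/-! ### Homology at the middle compared with the cokernel of the incoming map. -/

section Homology

variable {A B C : Type*} [AddCommGroup A] [AddCommGroup B] [AddCommGroup C]
  (f : A →ₗ[ℤ] B) (g : B →ₗ[ℤ] C)

/-- The map from the homology of `A → B → C` at the middle to the cokernel of `A → B`. -/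
def homologyToCokernel :
    (LinearMap.ker g ⧸ (LinearMap.range f).submoduleOf (LinearMap.ker g)) →ₗ[ℤ]
      (B ⧸ LinearMap.range f) :=
  Submodule.mapQ _ _ (LinearMap.ker g).subtype le_rfl

theorem homologyToCokernel_injective : Function.Injective (homologyToCokernel f g) := by
  rw [injective_iff_map_eq_zero]
  intro x
  obtain ⟨x, rfl⟩ := Submodule.mkQ_surjective _ x
  intro h
  exact (Submodule.Quotient.mk_eq_zero _).2
    ((Submodule.Quotient.mk_eq_zero (LinearMap.range f) (x := x.1)).1 h)

/-- If `n • y` lies in the image of `f` with `n > 0`, then `n • g y = 0`, so `g y = 0` because `C`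
is torsion-free. Thus every torsion class of the cokernel is represented by a cycle. -/
theorem nonempty_torsion_homology_equiv [Module.IsTorsionFree ℤ C] (h : g ∘ₗ f = 0) :
    Nonempty (AddCommGroup.torsion
        (LinearMap.ker g ⧸ (LinearMap.range f).submoduleOf (LinearMap.ker g)) ≃+
      AddCommGroup.torsion (B ⧸ LinearMap.range f)) := by
  refine AddCommGroup.nonempty_torsion_equiv (homologyToCokernel f g).toAddMonoidHom
    (homologyToCokernel_injective f g) fun y hy => ?_
  obtain ⟨y, rfl⟩ := Submodule.mkQ_surjective _ y
  obtain ⟨n, hn, hy⟩ := AddCommGroup.mem_torsion_iff_exists_nsmul.1 hy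
  rw [← map_nsmul, Submodule.mkQ_apply, Submodule.Quotient.mk_eq_zero] at hy
  obtain ⟨x, hx⟩ := hy
  have h0 : n • g y = 0 := by
    rw [← map_nsmul, ← hx]
    exact LinearMap.congr_fun h x
  have h1 : ((n : ℤ)) • g y = 0 := by simpa using h0
  have hg : g y = 0 := (smul_eq_zero.1 h1).resolve_left (by exact_mod_cast hn.ne')
  exact ⟨Submodule.Quotient.mk ⟨y, hg⟩, rfl⟩

theorem nonempty_homology_equiv [Subsingleton C] :
    Nonempty ((LinearMap.ker g ⧸ (LinearMap.range f).submoduleOf (LinearMap.ker g)) ≃+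
      (B ⧸ LinearMap.range f)) := by
  refine ⟨AddEquiv.ofBijective (homologyToCokernel f g).toAddMonoidHom
    ⟨homologyToCokernel_injective f g, fun y => ?_⟩⟩
  obtain ⟨y, rfl⟩ := Submodule.mkQ_surjective _ y
  exact ⟨Submodule.Quotient.mk ⟨y, Subsingleton.elim _ _⟩, rfl⟩

end Homology

/-! ### Kernel and cokernel of the signless incidence map. -/

/-- The signless incidence map of a graph whose edge `e` has the ends `l e` and `r e`. -/
def signlessIncidence {V E : Type*} (l r : E → V) : (V → ℤ) →ₗ[ℤ] (E → ℤ) where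
  toFun f e := f (l e) + f (r e)
  map_add' f g := by ext e; simp; ring
  map_smul' a f := by ext e; simp; ring

@[simp]
theorem signlessIncidence_apply {V E : Type*} (l r : E → V) (f : V → ℤ) (e : E) :
    signlessIncidence l r f e = f (l e) + f (r e) := rfl

namespace Graph

variable {α β E : Type*} {G : Graph α β}

/-- The component of a vertex. -/
def componentOf (v : G.vertexSet) : G.Component := Quot.mk _ v

theorem componentOf_surjective : Function.Surjective (G.componentOf) := Quot.mk_surjective

theorem componentOf_eq_of_adj {x y : G.vertexSet} (h : G.Adj x y) :
    componentOf x = componentOf y := Quot.sound h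

/-- A function constant along edges is constant on components. -/
theorem eq_of_componentOf_eq {γ : Type*} (F : G.vertexSet → γ)
    (hF : ∀ x y : G.vertexSet, G.Adj x y → F x = F y) {x y : G.vertexSet}
    (h : componentOf x = componentOf y) : F x = F y :=
  congrArg (Quot.lift F hF) h

/-- A function whose values at adjacent vertices are opposite is killed by two on each component
which is not bipartite. -/
theorem add_self_eq_zero_of_not_isBipartite {A : Type*} [AddCommGroup A] (h : G.vertexSet → A)
    (hh : ∀ x y : G.vertexSet, G.Adj x y →
      ¬ (componentOf x).IsBipartite → h x + h y = 0) (v : G.vertexSet)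
    (hv : ¬ (componentOf v).IsBipartite) : h v + h v = 0 := by
  by_contra hne
  have hneg : h v ≠ -h v := fun h' => hne (by nth_rewrite 1 [h']; simp)
  -- Crossing an edge negates `h`, so on this component `h` takes only the values `h v` and `-h v`.
  -- If these differ, they give a 2-colouring, contradicting `hv`.
  have inv : ∀ w, componentOf w = componentOf v → h w = h v ∨ h w = -h v := by
    intro w hw
    have := eq_of_componentOf_eq
      (fun w => componentOf w = componentOf v → (h w = h v ∨ h w = -h v)) (fun x y hxy => by
        have hc := componentOf_eq_of_adj hxy
        simp only [hc, eq_iff_iff]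
        refine imp_congr_right fun hy => ?_
        have := eq_neg_of_add_eq_zero_left (hh x y hxy (by rw [hc, hy]; exact hv))
        rw [this, neg_eq_iff_eq_neg, neg_inj, or_comm]) hw
    simp only [hw, forall_const] at this
    rw [this]; simp
  classical
  refine hv ⟨fun w => decide (h w = h v), fun x y hxy hx => ?_⟩
  change componentOf x = _ at hx
  have hc := componentOf_eq_of_adj hxy
  have hxy' := eq_neg_of_add_eq_zero_left (hh x y hxy (by rw [hx]; exact hv))
  have hy := inv y (hc ▸ hx)
  rcases hy with hy | hy
  · rw [hy] at hxy'
    simp [hxy', hy, hneg.symm]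
  · rw [hy, neg_neg] at hxy'
    simp [hxy', hy, hneg.symm]

variable (G) in
/-- Signs which alternate on the bipartite components. -/
theorem exists_alternating_sign : ∃ ε : G.vertexSet → ℤˣ, ∀ x y : G.vertexSet, G.Adj x y →
    (componentOf x).IsBipartite → ε x = -ε y := by
  classical
  choose! f hf using fun (C : G.Component) (h : C.IsBipartite) => h
  refine ⟨fun w => if f (componentOf w) w then 1 else -1, fun x y hxy hx => ?_⟩
  have h1 := hf _ hx x y hxy rfl
  beta_reduce
  rw [← componentOf_eq_of_adj hxy]
  cases hx : f (componentOf x) x <;> cases hy : f (componentOf x) y <;> simp_all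

/-- `l` and `r` list the ends of the edges of `G`. -/
def ListsEnds (G : Graph α β) (l r : E → G.vertexSet) : Prop :=
  ∀ x y : G.vertexSet, G.Adj x y ↔ ∃ e, (l e = x ∧ r e = y) ∨ (l e = y ∧ r e = x)

namespace ListsEnds

variable {l r : E → G.vertexSet} (hlr : G.ListsEnds l r)
include hlr

theorem adj (e : E) : G.Adj (l e) (r e) := (hlr _ _).2 ⟨e, Or.inl ⟨rfl, rfl⟩⟩

theorem rel_of_adj {R : G.vertexSet → G.vertexSet → Prop} (hR : ∀ x y, R x y → R y x)
    (h : ∀ e, R (l e) (r e)) {x y : G.vertexSet} (hxy : G.Adj x y) : R x y := by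
  obtain ⟨e, ⟨rfl, rfl⟩ | ⟨rfl, rfl⟩⟩ := (hlr _ _).1 hxy
  · exact h e
  · exact hR _ _ (h e)

/-- Shows that a torsion class is represented by an edge function constant on components and zero on
bipartite ones. The idea is to correct `f` by the kernel until `2f` is divisible by `n`, then to
split `2f / n` into a part constant on components and an even part `2u`. -/
theorem exists_lift_of_torsion [Finite G.vertexSet] {x : E → ℤ} {n : ℕ} (hn : 0 < n)
    {f : G.vertexSet → ℤ} (hf : signlessIncidence l r f = n • x) :
    ∃ (g : G.Component → ℤ) (u : G.vertexSet → ℤ), (∀ C, C.IsBipartite → g C = 0) ∧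
      ∀ e, x e = g (componentOf (l e)) + (u (l e) + u (r e)) := by
  classical
  have hn' : (n : ℤ) ≠ 0 := by exact_mod_cast hn.ne'
  obtain ⟨ε, hε⟩ := exists_alternating_sign G
  choose root hroot using componentOf_surjective (G := G)
  -- On a bipartite component, subtract the alternating kernel element that agrees with `f` at the
  -- root.
  let f' : G.vertexSet → ℤ := fun v =>
    if (componentOf v).IsBipartite then
      f v - ε v * (ε (root (componentOf v)) * f (root (componentOf v))) else f v
  have hf' : ∀ e, f' (l e) + f' (r e) = n * x e := by
    intro e
    have h1 : f (l e) + f (r e) = n * x e := by simpa using congrFun hf e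
    have hc := componentOf_eq_of_adj (hlr.adj e)
    by_cases hb : (componentOf (l e)).IsBipartite
    · have h2 := hε _ _ (hlr.adj e) hb
      simp only [f', ← hc, hb, if_true, h2]
      push_cast
      linarith
    · simp only [f', ← hc, hb, if_false, h1]
  have hadj : ∀ x y : G.vertexSet, G.Adj x y → (n : ℤ) ∣ f' x + f' y := fun x y hxy =>
    hlr.rel_of_adj (R := fun x y => (n : ℤ) ∣ f' x + f' y)
      (fun x y h => by rwa [add_comm]) (fun e => ⟨_, hf' e⟩) hxy
  -- `f'` vanishes at the root, and divisibility by `n` propagates along edges.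
  have hbip : ∀ v, (componentOf v).IsBipartite → (n : ℤ) ∣ f' v := by
    intro v hv
    have h0 : f' (root (componentOf v)) = 0 := by
      have hb : (componentOf (root (componentOf v))).IsBipartite := by rwa [hroot]
      have h1 : (ε (root (componentOf v)) : ℤ) * ε (root (componentOf v)) = 1 := by
        rw [← Units.val_mul, Int.units_mul_self, Units.val_one]
      simp only [f', hroot, hv, if_true]
      rw [← mul_assoc, h1]; ring
    have := eq_of_componentOf_eq (fun w => (n : ℤ) ∣ f' w) (fun x y hxy => by
      rw [eq_iff_iff]
      exact ⟨fun h => (dvd_add_right h).1 (hadj x y hxy),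
        fun h => (dvd_add_left h).1 (hadj x y hxy)⟩) (hroot (componentOf v))
    rw [← this, h0]
    exact dvd_zero _
  have hnb : ∀ v, (n : ℤ) ∣ 2 * f' v := by
    intro v
    by_cases hv : (componentOf v).IsBipartite
    · exact (hbip v hv).mul_left _
    -- Modulo `n` the function alternates, so non-bipartiteness kills twice its values. For even `n`
    -- the factor 2 cannot be dropped; this is the source of the 2-torsion.
    have := add_self_eq_zero_of_not_isBipartite (fun w => (f' w : ZMod n)) (fun x y hxy _ => by
      rw [← Int.cast_add, ZMod.intCast_zmod_eq_zero_iff_dvd]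
      exact hadj x y hxy) v hv
    rw [← Int.cast_add, ZMod.intCast_zmod_eq_zero_iff_dvd] at this
    rwa [two_mul]
  choose q hq using hnb
  have hqe : ∀ e, q (l e) + q (r e) = 2 * x e := by
    intro e
    have := hf' e
    refine mul_left_cancel₀ hn' ?_
    rw [mul_add, ← hq, ← hq, ← mul_add, this]; ring
  have hpar : ∀ v, (2 : ℤ) ∣ q v - q (root (componentOf v)) := by
    intro v
    have := eq_of_componentOf_eq (fun w => (2 : ℤ) ∣ q v - q w) (fun x y hxy => by
      have : (2 : ℤ) ∣ q x + q y := hlr.rel_of_adj (R := fun x y => (2 : ℤ) ∣ q x + q y)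
        (fun x y h => by rwa [add_comm]) (fun e => ⟨_, hqe e⟩) hxy
      rw [eq_iff_iff]; omega) (hroot (componentOf v))
    simp only [sub_self, dvd_zero, eq_iff_iff, iff_true] at this
    exact this
  have hbip2 : ∀ v, (componentOf v).IsBipartite → (2 : ℤ) ∣ q v := by
    intro v hv
    obtain ⟨k, hk⟩ := hbip v hv
    refine ⟨k, mul_left_cancel₀ hn' ?_⟩
    rw [← hq, hk]; ring
  -- The parity of `q` is constant on components, so subtracting the root value leaves an even
  -- function. On bipartite components `q` is already even and 0 suffices.
  let g : G.Component → ℤ := fun C => if C.IsBipartite then 0 else q (root C)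
  have hg : ∀ v, (2 : ℤ) ∣ q v - g (componentOf v) := by
    intro v
    by_cases hv : (componentOf v).IsBipartite
    · simpa [g, hv] using hbip2 v hv
    · simpa [g, hv] using hpar v
  choose u hu using hg
  refine ⟨g, u, fun C hC => by simp [g, hC], fun e => ?_⟩
  have h1 := hu (l e)
  have h2 := hu (r e)
  rw [← componentOf_eq_of_adj (hlr.adj e)] at h2
  have := hqe e
  linarith

/-- The torsion of the cokernel of the signless incidence map. -/
theorem nonempty_torsion_coker_equiv [Finite G.vertexSet] :
    Nonempty (AddCommGroup.torsion ((E → ℤ) ⧸ LinearMap.range (signlessIncidence l r)) ≃+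
      ({C : G.Component // ¬ C.IsBipartite} → ZMod 2)) := by
  classical
  let φ₀ : ({C : G.Component // ¬ C.IsBipartite} → ℤ) →+ (E → ℤ) :=
    { toFun := fun g e => if h : (componentOf (l e)).IsBipartite then 0
        else g ⟨componentOf (l e), h⟩
      map_zero' := by ext e; simp
      map_add' := fun g g' => by ext e; by_cases h : (componentOf (l e)).IsBipartite <;> simp [h] }
  let φ := (LinearMap.range (signlessIncidence l r)).mkQ.toAddMonoidHom.comp φ₀
  have hφ : ∀ g, φ g = 0 ↔ ∃ f, signlessIncidence l r f = φ₀ g := fun g => by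
    change Submodule.Quotient.mk (φ₀ g) = 0 ↔ _
    rw [Submodule.Quotient.mk_eq_zero]; rfl
  let ext0 : ({C : G.Component // ¬ C.IsBipartite} → ℤ) → G.vertexSet → ℤ := fun g v =>
    if h : (componentOf v).IsBipartite then 0 else g ⟨componentOf v, h⟩
  have hext : ∀ g e, ext0 g (r e) = φ₀ g e := fun g e => by
    change (if h : (componentOf (r e)).IsBipartite then 0 else g ⟨componentOf (r e), h⟩)
      = if h : (componentOf (l e)).IsBipartite then 0 else g ⟨componentOf (l e), h⟩
    simp only [componentOf_eq_of_adj (hlr.adj e)]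
  have hext' : ∀ g e, ext0 g (l e) = φ₀ g e := fun g e => rfl
  -- Extending `g` to vertices, constant on components, gives a function whose image is `2 • φ₀ g`.
  have htwo : ∀ g, φ (2 • g) = 0 := fun g => (hφ _).2 ⟨ext0 g, by
    ext e
    rw [map_nsmul, signlessIncidence_apply, hext, hext', two_nsmul]; rfl⟩
  have htor : ∀ g, φ g ∈ AddCommGroup.torsion _ := fun g =>
    AddCommGroup.mem_torsion_iff_exists_nsmul.2 ⟨2, two_pos, by rw [← map_nsmul, htwo]⟩
  let ψ : ({C : G.Component // ¬ C.IsBipartite} → ℤ) →+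
      ({C : G.Component // ¬ C.IsBipartite} → ZMod 2) :=
    (Int.castAddHom (ZMod 2)).compLeft _
  refine AddMonoidHom.nonempty_equiv_of_ker_eq (φ.codRestrict _ htor) ψ ?_ ?_ ?_
  · rintro ⟨y, hy⟩
    obtain ⟨x, rfl⟩ := Submodule.mkQ_surjective _ y
    obtain ⟨n, hn, hx⟩ := AddCommGroup.mem_torsion_iff_exists_nsmul.1 hy
    rw [← map_nsmul, Submodule.mkQ_apply, Submodule.Quotient.mk_eq_zero] at hx
    obtain ⟨f, hf⟩ := hx
    obtain ⟨g, u, hg, hx⟩ := hlr.exists_lift_of_torsion hn hf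
    refine ⟨fun C => g C, Subtype.ext ?_⟩
    change Submodule.Quotient.mk (φ₀ _) = Submodule.Quotient.mk x
    rw [eq_comm, Submodule.Quotient.eq]
    refine ⟨u, ?_⟩
    ext e
    rw [Pi.sub_apply, hx e, signlessIncidence_apply]
    by_cases h : (componentOf (l e)).IsBipartite
    · simp [φ₀, h, hg _ h]
    · simp [φ₀, h]
  · intro y
    choose g hg using fun C => ZMod.intCast_surjective (y C)
    exact ⟨g, funext hg⟩
  · intro g
    refine Subtype.ext_iff.trans ?_
    change φ g = 0 ↔ _
    constructor
    · rw [hφ]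
      rintro ⟨f, hf⟩
      ext ⟨C, hC⟩
      -- If `φ₀ g` is the image of `f`, then `2f - g` alternates along edges, hence vanishes on a
      -- non-bipartite component, where `g` is therefore even.
      obtain ⟨v, rfl⟩ := componentOf_surjective C
      have h0 := add_self_eq_zero_of_not_isBipartite (fun w => 2 * f w - ext0 g w)
        (fun x y hxy _ => hlr.rel_of_adj
          (R := fun x y => 2 * f x - ext0 g x + (2 * f y - ext0 g y) = 0)
          (fun x y h => by rwa [add_comm]) (fun e => by
            have := congrFun hf e
            rw [signlessIncidence_apply] at this
            rw [hext, hext', ← this]; ring) hxy) v hC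
      have h1 : g ⟨componentOf v, hC⟩ = 2 * f v := by
        have : ext0 g v = g ⟨componentOf v, hC⟩ := by simp [ext0, hC]
        rw [← this]; linarith
      change ((g ⟨componentOf v, hC⟩ : ℤ) : ZMod 2) = 0
      rw [h1, ZMod.intCast_zmod_eq_zero_iff_dvd]
      exact ⟨_, rfl⟩
    · intro h
      have : ∀ C, ∃ k, g C = 2 * k := fun C => by
        have h2 : ((g C : ℤ) : ZMod 2) = 0 := congrFun h C
        rw [ZMod.intCast_zmod_eq_zero_iff_dvd] at h2
        exact h2
      choose k hk using this
      have : g = 2 • k := by ext C; simp [hk]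
      rw [this, htwo]

/-- The kernel of the signless incidence map has a basis indexed by the bipartite components. -/
theorem nonempty_ker_equiv :
    Nonempty (LinearMap.ker (signlessIncidence l r) ≃ₗ[ℤ]
      ({C : G.Component // C.IsBipartite} → ℤ)) := by
  classical
  obtain ⟨ε, hε⟩ := exists_alternating_sign G
  choose root hroot using componentOf_surjective (G := G)
  have hsq : ∀ v, (ε v : ℤ) * ε v = 1 := fun v => by
    rw [← Units.val_mul, Int.units_mul_self, Units.val_one]
  -- An alternating function on a bipartite component is determined by its value at the root,
  -- normalised by the sign `ε` there.
  let φ : LinearMap.ker (signlessIncidence l r) →ₗ[ℤ] ({C : G.Component // C.IsBipartite} → ℤ) :=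
    { toFun := fun f C => ε (root C) * f.1 (root C)
      map_add' := fun f g => by ext C; simp [mul_add]
      map_smul' := fun a f => by ext C; simp [mul_left_comm] }
  have hadj : ∀ f ∈ LinearMap.ker (signlessIncidence l r), ∀ x y : G.vertexSet, G.Adj x y →
      f x + f y = 0 := fun f hf x y hxy =>
    hlr.rel_of_adj (R := fun x y => f x + f y = 0) (fun x y h => by rwa [add_comm])
      (fun e => congrFun hf e) hxy
  refine ⟨LinearEquiv.ofBijective φ ⟨?_, fun g => ?_⟩⟩
  · rw [injective_iff_map_eq_zero]
    rintro ⟨f, hf⟩ h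
    ext v
    change f v = 0
    by_cases hv : (componentOf v).IsBipartite
    · have h1 : (ε (root (componentOf v)) : ℤ) * f (root (componentOf v)) = 0 :=
        congrFun h ⟨_, hv⟩
      have h2 := eq_of_componentOf_eq
        (fun w => if (componentOf w).IsBipartite then ε w * f w else 0) (fun x y hxy => by
          have hc := componentOf_eq_of_adj hxy
          by_cases hb : (componentOf x).IsBipartite
          · have := hadj f hf x y hxy
            simp only [← hc, hb, if_true, hε x y hxy hb, eq_neg_of_add_eq_zero_left this]
            push_cast; ring
          · simp only [← hc, hb, if_false]) (hroot (componentOf v))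
      simp only [hroot, hv, if_true, h1] at h2
      rcases mul_eq_zero.1 h2.symm with h3 | h3
      · exact absurd h3 (ε v).ne_zero
      · exact h3
    · have := add_self_eq_zero_of_not_isBipartite f (fun x y hxy _ => hadj f hf x y hxy) v hv
      omega
  · refine ⟨⟨fun v => if h : (componentOf v).IsBipartite then ε v * g ⟨_, h⟩ else 0, ?_⟩, ?_⟩
    · rw [LinearMap.mem_ker]
      ext e
      rw [signlessIncidence_apply]
      simp only [componentOf_eq_of_adj (hlr.adj e)]
      by_cases hb : (componentOf (r e)).IsBipartite
      · have := hε _ _ (hlr.adj e) (by rwa [componentOf_eq_of_adj (hlr.adj e)])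
        simp [hb, this]
      · simp [hb]
    · ext ⟨C, hC⟩
      simp only [φ, LinearMap.coe_mk, AddHom.coe_mk, hroot, hC, dif_pos, ← mul_assoc, hsq, one_mul]

/-- Rank-nullity, with the rank of the kernel read off from `nonempty_ker_equiv`; the additive form
avoids truncated subtraction. -/
theorem finrank_coker [Finite G.vertexSet] [Finite E] :
    Module.finrank ℤ ((E → ℤ) ⧸ LinearMap.range (signlessIncidence l r)) + Nat.card G.vertexSet =
      Nat.card E + G.numBipartiteComponents := by
  have := Fintype.ofFinite G.vertexSet
  have := Fintype.ofFinite E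
  have : Finite G.Component := Finite.of_surjective _ componentOf_surjective
  have := Fintype.ofFinite {C : G.Component // C.IsBipartite}
  obtain ⟨k⟩ := hlr.nonempty_ker_equiv
  have h1 := Submodule.finrank_quotient_add_finrank (LinearMap.range (signlessIncidence l r))
  have h2 := Submodule.finrank_quotient_add_finrank (LinearMap.ker (signlessIncidence l r))
  rw [k.finrank_eq, (signlessIncidence l r).quotKerEquivRange.finrank_eq] at h2
  simp only [Module.finrank_fintype_fun_eq_card, ← Nat.card_eq_fintype_card] at h1 h2
  unfold numBipartiteComponents
  omega

end ListsEnds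

theorem natCard_not_isBipartite [Finite G.vertexSet] :
    (Nat.card {C : G.Component // ¬ C.IsBipartite} : ℤ) =
      G.numComponents - G.numBipartiteComponents := by
  classical
  have : Finite G.Component := Finite.of_surjective _ componentOf_surjective
  have := Fintype.ofFinite G.Component
  have h := Nat.card_congr (Equiv.sumCompl fun C : G.Component => C.IsBipartite)
  rw [Nat.card_sum] at h
  unfold numComponents numBipartiteComponents
  omega

end Graph

/-- A subset of a finite type stable under a fixed-point-free involution has even cardinality. -/
theorem Finset.even_card_of_involution {X : Type*} (K : Finset X) (f : X → X)
    (hK : ∀ x ∈ K, f x ∈ K) (hf : ∀ x ∈ K, f (f x) = x) (hne : ∀ x ∈ K, f x ≠ x) :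
    Even K.card := by
  have h := Finset.sum_involution (s := K) (f := fun _ => (1 : ZMod 2)) (fun x _ => f x)
    (fun _ _ => rfl) (fun x hx _ => hne x hx) hK hf
  rw [Finset.sum_const, nsmul_eq_mul, mul_one] at h
  exact (ZMod.natCast_eq_zero_iff_even).1 h

/-! ### Circles of a smoothing and the effect of changing one marker. -/

namespace LinkDiagram

variable {D : LinkDiagram}

theorem smoothEnd_smoothEnd (m : ℤˣ) (i : Fin 4) : smoothEnd m (smoothEnd m i) = i := by
  unfold smoothEnd
  split_ifs <;> fin_cases i <;> rfl

theorem smoothEnd_ne (m : ℤˣ) (i : Fin 4) : smoothEnd m i ≠ i := by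
  unfold smoothEnd
  split_ifs <;> fin_cases i <;> decide

theorem circleOf_surjective (s : D.KState) : Function.Surjective (D.circleOf s) :=
  Quot.mk_surjective

theorem circleOf_glue (s : D.KState) (d : Fin D.N × Fin 4) :
    D.circleOf s (Sum.inl (D.glue d)) = D.circleOf s (Sum.inl d) :=
  (Quot.sound (Step.arc d)).symm

theorem circleOf_smoothEnd (s : D.KState) (c : Fin D.N) (i : Fin 4) :
    D.circleOf s (Sum.inl (c, smoothEnd (s c) i)) = D.circleOf s (Sum.inl (c, i)) :=
  (Quot.sound (Step.smooth c i)).symm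

/-- A function on pieces which is invariant under the steps is constant on circles. -/
theorem eq_of_circleOf_eq {γ : Type*} {s : D.KState} (F : D.Piece → γ)
    (harc : ∀ d, F (Sum.inl (D.glue d)) = F (Sum.inl d))
    (hsm : ∀ c i, F (Sum.inl (c, smoothEnd (s c) i)) = F (Sum.inl (c, i)))
    {x y : D.Piece} (h : D.circleOf s x = D.circleOf s y) : F x = F y :=
  congrArg (Quot.lift F (by
    rintro _ _ (⟨d⟩ | ⟨c, i⟩)
    · exact (harc d).symm
    · exact (hsm c i).symm)) h

/-- The circle of `x` in `D_s` runs through the crossing `c`. -/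
def Through (s : D.KState) (c : Fin D.N) (x : D.Piece) : Prop :=
  ∃ i : Fin 4, D.circleOf s (Sum.inl (c, i)) = D.circleOf s x

theorem through_self (s : D.KState) (c : Fin D.N) (i : Fin 4) : Through s c (Sum.inl (c, i)) :=
  ⟨i, rfl⟩

theorem through_congr {s : D.KState} {c : Fin D.N} {x y : D.Piece}
    (h : D.circleOf s x = D.circleOf s y) : Through s c x ↔ Through s c y := by
  unfold Through; rw [h]

/-- Two states which agree except possibly at `c`. -/
def AgreeOff (c : Fin D.N) (s s' : D.KState) : Prop := ∀ c', c' ≠ c → s c' = s' c'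

theorem AgreeOff.symm {c : Fin D.N} {s s' : D.KState} (h : AgreeOff c s s') : AgreeOff c s' s :=
  fun c' hc => (h c' hc).symm

theorem agreeOff_update (c : Fin D.N) (s : D.KState) (m : ℤˣ) :
    AgreeOff c s (Function.update s c m) := fun c' hc => by
  rw [Function.update_of_ne hc]

theorem circleOf_end_eq_or (s : D.KState) (c : Fin D.N) (i : Fin 4) :
    D.circleOf s (Sum.inl (c, i)) = D.circleOf s (Sum.inl (c, 0)) ∨
      D.circleOf s (Sum.inl (c, i)) = D.circleOf s (Sum.inl (c, 2)) := by
  have h0 := circleOf_smoothEnd s c 0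
  have h2 := circleOf_smoothEnd s c 2
  rcases Int.units_eq_one_or (s c) with h | h <;> rw [h] at h0 h2
  · replace h0 : D.circleOf s (Sum.inl (c, 1)) = D.circleOf s (Sum.inl (c, 0)) := h0
    replace h2 : D.circleOf s (Sum.inl (c, 3)) = D.circleOf s (Sum.inl (c, 2)) := h2
    fin_cases i <;> simp [h0, h2]
  · replace h0 : D.circleOf s (Sum.inl (c, 3)) = D.circleOf s (Sum.inl (c, 0)) := h0
    replace h2 : D.circleOf s (Sum.inl (c, 1)) = D.circleOf s (Sum.inl (c, 2)) := h2
    fin_cases i <;> simp [h0, h2]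

theorem through_iff {s : D.KState} {c : Fin D.N} {x : D.Piece} :
    Through s c x ↔ D.circleOf s x = D.circleOf s (Sum.inl (c, 0)) ∨
      D.circleOf s x = D.circleOf s (Sum.inl (c, 2)) := by
  constructor
  · rintro ⟨i, hi⟩
    rw [← hi]
    exact circleOf_end_eq_or s c i
  · rintro (h | h)
    · exact ⟨0, h.symm⟩
    · exact ⟨2, h.symm⟩

section AgreeOff

variable {c : Fin D.N} {s s' : D.KState} (h : AgreeOff c s s')
include h

/-- Away from `c` the steps of `s'` are steps of `s`; at `c` all four ends run through `c` anyway.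
-/
theorem AgreeOff.through_congr_step {x y : D.Piece} (hxy : D.circleOf s' x = D.circleOf s' y) :
    Through s c x ↔ Through s c y := by
  refine Eq.to_iff (eq_of_circleOf_eq (s := s') (fun x => Through s c x) (fun d => ?_)
    (fun c' i => ?_) hxy)
  · exact propext (through_congr (circleOf_glue s d))
  · by_cases hc : c' = c
    · subst hc
      simp only [through_self]
    · rw [← h c' hc]
      exact propext (through_congr (circleOf_smoothEnd s c' i))

/-- Whether a circle runs through `c` does not depend on the marker of `c`. -/
theorem AgreeOff.through_iff_through (x : D.Piece) : Through s c x ↔ Through s' c x := by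
  have key : ∀ {s s' : D.KState}, AgreeOff c s s' → Through s' c x → Through s c x := by
    rintro s s' h ⟨i, hi⟩
    exact (h.through_congr_step hi).1 (through_self s c i)
  exact ⟨key h.symm, key h⟩

-- Once all circles of `D_s` through `c` are collapsed to one, it no longer matters how the ends at
-- `c` are joined, so the collapsed circle is an invariant of the circles of `D_{s'}`.
open Classical in
theorem AgreeOff.transfer_eq {x y : D.Piece} (hxy : D.circleOf s' x = D.circleOf s' y) :
    (if Through s c x then D.circleOf s (Sum.inl (c, 0)) else D.circleOf s x) =
      if Through s c y then D.circleOf s (Sum.inl (c, 0)) else D.circleOf s y := by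
  refine eq_of_circleOf_eq (s := s') (fun x => if Through s c x then
    D.circleOf s (Sum.inl (c, 0)) else D.circleOf s x) (fun d => ?_) (fun c' i => ?_) hxy
  · simp only [through_congr (circleOf_glue s d), circleOf_glue]
  · by_cases hc : c' = c
    · subst hc
      simp only [through_self, if_true]
    · rw [← h c' hc]
      simp only [through_congr (circleOf_smoothEnd s c' i), circleOf_smoothEnd]

open Classical in
/-- The map on circles which sends all circles through `c` to the circle of `(c, 0)` and keeps the
other circles. -/
noncomputable def AgreeOff.transfer : D.Circle s' → D.Circle s :=
  Quot.lift (fun x => if Through s c x then D.circleOf s (Sum.inl (c, 0)) else D.circleOf s x)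
    fun _ _ hxy => h.transfer_eq (Quot.sound hxy)

open Classical in
theorem AgreeOff.transfer_circleOf (x : D.Piece) : h.transfer (D.circleOf s' x) =
    if Through s c x then D.circleOf s (Sum.inl (c, 0)) else D.circleOf s x := rfl

/-- Circles which do not run through `c` do not depend on the marker of `c`. -/
theorem AgreeOff.circleOf_eq_iff_of_not_through {x y : D.Piece} (hx : ¬ Through s c x) :
    D.circleOf s x = D.circleOf s y ↔ D.circleOf s' x = D.circleOf s' y := by
  constructor
  · intro hxy
    have hx' := (not_congr (h.through_iff_through x)).1 hx
    have hy' := (not_congr (h.through_iff_through y)).1 (fun hy => hx ((through_congr hxy).2 hy))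
    simpa only [hx', hy', if_false] using h.symm.transfer_eq hxy
  · intro hxy
    have hy := (not_congr (h.through_congr_step hxy)).1 hx
    simpa only [hx, hy, if_false] using h.transfer_eq hxy

/-- At most two circles of `D_{s'}` run through `c`, those of the ends 0 and 2, and these are the
only ones `transfer` can identify. Discarding one of them, or having them equal, gives injectivity.
-/
theorem AgreeOff.transfer_injOn :
    Set.InjOn h.transfer {u | u ≠ D.circleOf s' (Sum.inl (c, 2)) ∨
      D.circleOf s' (Sum.inl (c, 0)) = D.circleOf s' (Sum.inl (c, 2))} := by
  intro u hu w hw huw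
  obtain ⟨x, rfl⟩ := circleOf_surjective s' u
  obtain ⟨y, rfl⟩ := circleOf_surjective s' w
  rw [h.transfer_circleOf, h.transfer_circleOf] at huw
  by_cases hx : Through s c x <;> by_cases hy : Through s c y
  · rw [h.through_iff_through, through_iff] at hx hy
    simp only [Set.mem_ofPred_eq] at hu hw
    grind
  · simp only [hx, hy, if_true, if_false] at huw
    exact absurd ⟨0, huw⟩ hy
  · simp only [hx, hy, if_true, if_false] at huw
    exact absurd ⟨0, huw.symm⟩ hx
  · simp only [hx, hy, if_false] at huw
    exact (h.circleOf_eq_iff_of_not_through hx).1 huw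

/-- Changing one marker adds at most one circle. -/
theorem AgreeOff.numCircles_le : D.numCircles s' ≤ D.numCircles s + 1 := by
  classical
  have h1 : Nat.card {u : D.Circle s' // ¬ u = D.circleOf s' (Sum.inl (c, 2))} ≤ D.numCircles s :=
    Nat.card_le_card_of_injective (fun u => h.transfer u.1) fun u w huw =>
      Subtype.ext (h.transfer_injOn (Or.inl u.2) (Or.inl w.2) huw)
  have h2 := Nat.card_congr
    (Equiv.sumCompl fun u : D.Circle s' => u = D.circleOf s' (Sum.inl (c, 2)))
  rw [Nat.card_sum, Nat.card_unique] at h2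
  unfold numCircles at *
  omega

end AgreeOff

/-- Adjacency of pieces when the crossing `c` is cut open. -/
def CutStep (s : D.KState) (c : Fin D.N) (x y : D.Piece) : Prop :=
  (∃ d, x = Sum.inl d ∧ y = Sum.inl (D.glue d)) ∨
    ∃ c' i, c' ≠ c ∧ x = Sum.inl (c', i) ∧ y = Sum.inl (c', smoothEnd (s c') i)

theorem AgreeOff.circleOf_eq_of_cut {c : Fin D.N} {s s' : D.KState} (h : AgreeOff c s s')
    {x y : D.Piece} (hxy : Quot.mk (CutStep s c) x = Quot.mk (CutStep s c) y) :
    D.circleOf s' x = D.circleOf s' y := by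
  refine congrArg (Quot.lift (D.circleOf s') ?_) hxy
  rintro _ _ (⟨d, rfl, rfl⟩ | ⟨c', i, hc, rfl, rfl⟩)
  · exact (circleOf_glue s' d).symm
  · rw [h c' hc]
    exact (circleOf_smoothEnd s' c' i).symm

/-- An end at a crossing which is cut open is still connected to another end at that crossing. -/
theorem exists_ne_cut_eq (s : D.KState) (c : Fin D.N) (i : Fin 4) :
    ∃ j, j ≠ i ∧ Quot.mk (CutStep s c) (Sum.inl (c, j)) = Quot.mk (CutStep s c) (Sum.inl (c, i)) := by
  classical
  by_contra! hcon
  let P : Fin D.N × Fin 4 → Prop := fun d =>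
    Quot.mk (CutStep s c) (Sum.inl d) = Quot.mk (CutStep s c) (Sum.inl (c, i))
  have hPg : ∀ d, P d → P (D.glue d) := fun d hd =>
    (Quot.sound (r := CutStep s c) (Or.inl ⟨d, rfl, rfl⟩)).symm.trans hd
  have hPs : ∀ c' j, c' ≠ c → P (c', j) → P (c', smoothEnd (s c') j) := fun c' j hc hd =>
    (Quot.sound (r := CutStep s c) (Or.inr ⟨c', j, hc, rfl, rfl⟩)).symm.trans hd
  -- Parity argument on the set `K` of ends connected to `(c, i)` after cutting: `glue` pairs up all
  -- of `K`, while, if `(c, i)` were its only end at `c`, the smoothings would pair up `K` without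
  -- that end.
  let K : Finset (Fin D.N × Fin 4) := Finset.univ.filter P
  have h1 : Even K.card := K.even_card_of_involution D.glue
    (fun d hd => by simpa [K] using hPg d (by simpa [K] using hd))
    (fun d _ => D.glue_glue d) (fun d _ => D.glue_ne d)
  have hi : (c, i) ∈ K := by simp [K, P]
  have hmem : ∀ d ∈ K.erase (c, i), P d ∧ d.1 ≠ c := by
    rintro ⟨c', j⟩ hd
    rw [Finset.mem_erase] at hd
    have hP : P (c', j) := by simpa [K] using hd.2
    refine ⟨hP, ?_⟩
    rintro rfl
    exact hcon j (fun hj => hd.1 (by rw [hj])) hP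
  have h2 : Even (K.erase (c, i)).card := by
    refine Finset.even_card_of_involution _ (fun d => (d.1, smoothEnd (s d.1) d.2)) ?_ ?_ ?_
    · rintro ⟨c', j⟩ hd
      obtain ⟨hP, hc⟩ := hmem _ hd
      rw [Finset.mem_erase]
      exact ⟨fun he => hc (congrArg Prod.fst he), by simpa [K] using hPs c' j hc hP⟩
    · rintro ⟨c', j⟩ _
      simp [smoothEnd_smoothEnd]
    · rintro ⟨c', j⟩ _ he
      exact smoothEnd_ne _ _ (congrArg Prod.snd he)
  rw [Finset.card_erase_of_mem hi] at h2
  have : 0 < K.card := Finset.card_pos.2 ⟨_, hi⟩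
  rw [Nat.even_iff] at h1 h2
  omega

section Merge

variable {c : Fin D.N} {s s' : D.KState} (h : AgreeOff c s s') (hc : s' c ≠ s c)
  (hs : D.circleOf s (Sum.inl (c, 0)) ≠ D.circleOf s (Sum.inl (c, 2)))
include h hc hs

/-- If the two strands at `c` lie on different circles, changing the marker merges these. -/
theorem AgreeOff.circleOf_eq_of_merge :
    D.circleOf s' (Sum.inl (c, 0)) = D.circleOf s' (Sum.inl (c, 2)) := by
  have hself : AgreeOff c s s := fun _ _ => rfl
  -- Since the ends 0 and 2 lie on different circles of `D_s`, `j` must be the end joined to 0 by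
  -- the old marker. The new marker joins that end to 2, and the path from 0 to `j` avoiding `c`
  -- survives.
  obtain ⟨j, hj, hcut⟩ := exists_ne_cut_eq s c 0
  have h1 := hself.circleOf_eq_of_cut hcut
  have h1' := h.circleOf_eq_of_cut hcut
  have h0 := circleOf_smoothEnd s c 0
  have h2 := circleOf_smoothEnd s c 2
  have h0' := circleOf_smoothEnd s' c 0
  have h2' := circleOf_smoothEnd s' c 2
  rcases Int.units_eq_one_or (s c) with hsc | hsc <;>
    rcases Int.units_eq_one_or (s' c) with hsc' | hsc'
  · exact absurd (hsc'.trans hsc.symm) hc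
  · rw [hsc] at h0 h2
    rw [hsc'] at h0' h2'
    simp only [smoothEnd] at h0 h2 h0' h2'
    fin_cases j <;> simp_all
  · rw [hsc] at h0 h2
    rw [hsc'] at h0' h2'
    simp only [smoothEnd] at h0 h2 h0' h2'
    fin_cases j <;> simp_all
  · exact absurd (hsc'.trans hsc.symm) hc

/-- `transfer` is a bijection onto the circles of `D_s` other than that of the end 2. -/
theorem AgreeOff.numCircles_of_merge : D.numCircles s' + 1 = D.numCircles s := by
  classical
  have hm := h.circleOf_eq_of_merge hc hs
  have hne : ∀ u, h.transfer u ≠ D.circleOf s (Sum.inl (c, 2)) := by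
    intro u
    obtain ⟨x, rfl⟩ := circleOf_surjective s' u
    rw [h.transfer_circleOf]
    split_ifs with hx
    · exact hs
    · exact fun he => hx ⟨2, he.symm⟩
  have h1 : D.numCircles s' = Nat.card {u : D.Circle s // ¬ u = D.circleOf s (Sum.inl (c, 2))} := by
    refine Nat.card_congr (Equiv.ofBijective (fun u => ⟨h.transfer u, hne u⟩) ⟨?_, ?_⟩)
    · intro u w huw
      exact h.transfer_injOn (Or.inr hm) (Or.inr hm) (congrArg Subtype.val huw)
    · rintro ⟨u, hu⟩
      obtain ⟨x, rfl⟩ := circleOf_surjective s u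
      refine ⟨D.circleOf s' x, Subtype.ext ((h.transfer_circleOf x).trans ?_)⟩
      split_ifs with hx
      · rcases through_iff.1 hx with hx | hx
        · exact hx.symm
        · exact absurd hx hu
      · rfl
  have h2 := Nat.card_congr
    (Equiv.sumCompl fun u : D.Circle s => u = D.circleOf s (Sum.inl (c, 2)))
  rw [Nat.card_sum, Nat.card_unique] at h2
  unfold numCircles at *
  omega

end Merge

/-- Pieces on a common circle after changing the marker of `c`. -/
theorem AgreeOff.eq_or_through {c : Fin D.N} {s s' : D.KState} (h : AgreeOff c s s')
    {x y : D.Piece} (hxy : D.circleOf s' x = D.circleOf s' y) :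
    D.circleOf s x = D.circleOf s y ∨ (Through s c x ∧ Through s c y) := by
  by_cases hx : Through s c x
  · exact Or.inr ⟨hx, (h.through_congr_step hxy).1 hx⟩
  · exact Or.inl ((h.circleOf_eq_iff_of_not_through hx).2 hxy)

end LinkDiagram

/-- Multiplied by `η`, each sign counts 1 if it equals `η` and -1 otherwise. This turns `σ` and `τ`
into numbers of markers and circles that differ from `η`. -/
theorem Int.units_mul_sum_add_card {X : Type*} [Fintype X] [DecidableEq X] (η : ℤˣ) (e : X → ℤˣ) :
    (η : ℤ) * ∑ x, (e x : ℤ) + 2 * (Finset.univ.filter fun x => e x ≠ η).card = Fintype.card X := by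
  rw [Finset.card_filter, Finset.mul_sum]
  push_cast
  rw [Finset.mul_sum, ← Finset.sum_add_distrib, ← Finset.card_univ, Finset.cast_card]
  refine Finset.sum_congr rfl fun x _ => ?_
  rcases Int.units_eq_one_or η with rfl | rfl <;>
    rcases Int.units_eq_one_or (e x) with h | h <;> rw [h] <;> decide

/-! ### Generators in the second extremal degree. -/

namespace LinkDiagram

variable {D : LinkDiagram}

theorem neg_unit_ne (η : ℤˣ) : -η ≠ η := (Int.units_ne_iff_eq_neg.2 rfl)

theorem units_eq_neg_of_ne {m η : ℤˣ} (h : m ≠ η) : m = -η := Int.units_ne_iff_eq_neg.1 h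

variable (D) in
/-- The state with all markers equal to `η`. -/
def constState (η : ℤˣ) : D.KState := fun _ => η

/-- The state with marker `-η` at `c` and `η` elsewhere. -/
def flipState (η : ℤˣ) (c : Fin D.N) : D.KState := Function.update (D.constState η) c (-η)

/-- The circles at the two strands of the crossing `c` in `D_s`. -/
def IsEnd (s : D.KState) (c : Fin D.N) (v : D.Circle s) : Prop :=
  v = D.circleOf s (Sum.inl (c, 0)) ∨ v = D.circleOf s (Sum.inl (c, 2))

/-- `G_s(D)` has no loops. -/
def IsAdequateState (s : D.KState) : Prop :=
  ∀ c, D.circleOf s (Sum.inl (c, 0)) ≠ D.circleOf s (Sum.inl (c, 2))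

/-- The enhanced states with `j` markers different from `η` in the second extremal degree `b`. -/
def IsLevel (η : ℤˣ) (j : ℤ) (S : D.EnhancedState) : Prop :=
  S.sigma = η * (D.N - 2 * j) ∧
    S.sigma + 2 * S.tau = η * (D.N + 2 * D.numCircles (D.constState η) - 4)

-- Eliminating `σ` and `τ` in favour of counts gives the formula from which the generators of levels
-- 0, 1 and 2 are determined.
open Classical in
theorem isLevel_mk_iff {η : ℤˣ} {j : ℤ} {s : D.KState} {e : D.Circle s → ℤˣ} :
    IsLevel η j ⟨s, e⟩ ↔
      ((Finset.univ.filter fun c => s c ≠ η).card : ℤ) = j ∧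
      2 * ((Finset.univ.filter fun x => e x ≠ η).card : ℤ) =
        D.numCircles s - D.numCircles (D.constState η) + 2 - j := by
  set S : D.EnhancedState := ⟨s, e⟩ with hS
  have h1 : (η : ℤ) * S.sigma + _ = _ := Int.units_mul_sum_add_card η s
  have h2 : (η : ℤ) * S.tau + _ = _ := Int.units_mul_sum_add_card η e
  rw [Fintype.card_fin] at h1
  rw [← Nat.card_eq_fintype_card] at h2
  change _ = (D.numCircles s : ℤ) at h2
  unfold IsLevel
  rcases Int.units_eq_one_or η with rfl | rfl
  · simp only [Units.val_one, one_mul] at *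
    omega
  · simp only [Units.val_neg, Units.val_one, neg_mul, one_mul] at *
    omega

open Classical in
/-- All markers are `η`, the circle `v` has sign `-η` and the others have sign `η`. -/
noncomputable def vertexGen (η : ℤˣ) (v : D.Circle (D.constState η)) : D.EnhancedState :=
  ⟨D.constState η, fun x => if x = v then -η else η⟩

/-- The marker of `c` is `-η`, all other markers and all signs are `η`. -/
def edgeGen (η : ℤˣ) (c : Fin D.N) : D.EnhancedState := ⟨flipState η c, fun _ => η⟩

open Classical in
theorem vertexGen_injective (η : ℤˣ) : Function.Injective (vertexGen (D := D) η) := by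
  intro v w h
  have h' : (fun x => if x = v then -η else η) = fun x => if x = w then -η else η := by
    simpa [vertexGen] using h
  have := congrFun h' v
  by_contra hvw
  simp only [if_true, if_neg hvw] at this
  exact neg_unit_ne η this

theorem flipState_self (η : ℤˣ) (c : Fin D.N) : flipState η c c = -η := Function.update_self ..

theorem flipState_of_ne (η : ℤˣ) {c c' : Fin D.N} (h : c' ≠ c) : flipState η c c' = η :=
  Function.update_of_ne h ..

theorem update_flipState_of_ne (η : ℤˣ) {c c' : Fin D.N} (h : c' ≠ c) :
    Function.update (flipState η c) c' η = flipState η c := by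
  rw [Function.update_eq_self_iff, flipState_of_ne η h]

theorem edgeGen_injective (η : ℤˣ) : Function.Injective (edgeGen (D := D) η) := by
  intro c c' h
  have h1 := congrFun (congrArg EnhancedState.state h) c
  by_contra hc
  change flipState η c c = flipState η c' c at h1
  rw [flipState_self, flipState_of_ne η hc] at h1
  exact neg_unit_ne η h1

theorem isLevel_vertexGen (η : ℤˣ) (v : D.Circle (D.constState η)) :
    IsLevel η 0 (vertexGen η v) := by
  classical
  rw [vertexGen, isLevel_mk_iff]
  constructor
  · simp [constState]
  · have : (Finset.univ.filter fun x => (if x = v then -η else η) ≠ η) = {v} := by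
      ext x
      by_cases hx : x = v
      · simp [hx, neg_unit_ne η]
      · simp [hx]
    rw [this, Finset.card_singleton]
    simp

theorem exists_vertexGen {η : ℤˣ} {S : D.EnhancedState} (h : IsLevel η 0 S) :
    ∃ v, vertexGen η v = S := by
  classical
  obtain ⟨s, e⟩ := S
  rw [isLevel_mk_iff] at h
  obtain ⟨h1, h2⟩ := h
  have hs : s = D.constState η := by
    have h0 : (Finset.univ.filter fun c => s c ≠ η).card = 0 := by exact_mod_cast h1
    rw [Finset.card_eq_zero, Finset.filter_eq_empty_iff] at h0
    ext1 c
    exact not_not.1 (h0 (Finset.mem_univ c))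
  subst hs
  have h3 : (Finset.univ.filter fun x => e x ≠ η).card = 1 := by
    omega
  obtain ⟨v, hv⟩ := Finset.card_eq_one.1 h3
  refine ⟨v, ?_⟩
  unfold vertexGen
  congr 1
  ext1 x
  have hx := Finset.ext_iff.1 hv x
  simp only [Finset.mem_filter, Finset.mem_univ, true_and, Finset.mem_singleton] at hx
  split_ifs with h
  · exact (units_eq_neg_of_ne (hx.2 h)).symm
  · exact (not_not.1 (mt hx.1 h)).symm

theorem numCircles_flipState {η : ℤˣ} (hA : IsAdequateState (D.constState η)) (c : Fin D.N) :
    D.numCircles (flipState η c) + 1 = D.numCircles (D.constState η) :=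
  (agreeOff_update c _ (-η)).numCircles_of_merge
    (by rw [Function.update_self]; exact neg_unit_ne η) (hA c)

theorem isLevel_edgeGen {η : ℤˣ} (hA : IsAdequateState (D.constState η)) (c : Fin D.N) :
    IsLevel η 1 (edgeGen η c) := by
  classical
  rw [edgeGen, isLevel_mk_iff]
  constructor
  · have : (Finset.univ.filter fun c' => flipState η c c' ≠ η) = {c} := by
      ext c'
      by_cases hc : c' = c
      · simp [hc, flipState_self, neg_unit_ne η]
      · simp [hc, flipState_of_ne η hc]
    rw [this, Finset.card_singleton]; rfl
  · have := numCircles_flipState hA c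
    simp only [ne_eq, not_true_eq_false, Finset.filter_false, Finset.card_empty]
    omega

theorem exists_edgeGen {η : ℤˣ} (hA : IsAdequateState (D.constState η)) {S : D.EnhancedState}
    (h : IsLevel η 1 S) : ∃ c, edgeGen η c = S := by
  classical
  obtain ⟨s, e⟩ := S
  rw [isLevel_mk_iff] at h
  obtain ⟨h1, h2⟩ := h
  obtain ⟨c, hc⟩ := Finset.card_eq_one.1 (show (Finset.univ.filter fun c => s c ≠ η).card = 1 by
    exact_mod_cast h1)
  have hmem := fun c' => Finset.ext_iff.1 hc c'
  simp only [Finset.mem_filter, Finset.mem_univ, true_and, Finset.mem_singleton] at hmem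
  have hs : s = flipState η c := by
    ext1 c'
    by_cases h : c' = c
    · subst h
      rw [flipState_self]
      exact units_eq_neg_of_ne ((hmem c').2 rfl)
    · rw [flipState_of_ne η h]
      exact not_not.1 (mt (hmem c').1 h)
  subst hs
  have h3 := numCircles_flipState hA c
  -- The merge gives `|s| = |s_η| - 1`, so the count of wrong signs at level 1 is zero.
  have h0 : (Finset.univ.filter fun x => e x ≠ η).card = 0 := by
    omega
  rw [Finset.card_eq_zero, Finset.filter_eq_empty_iff] at h0
  refine ⟨c, ?_⟩
  unfold edgeGen
  congr 1
  ext1 x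
  exact (not_not.1 (h0 (Finset.mem_univ x))).symm

/-- An enhanced state of level two changes two crossings joining the same pair of circles. -/
theorem exists_parallel {η : ℤˣ} (hA : IsAdequateState (D.constState η)) {S : D.EnhancedState}
    (h : IsLevel η 2 S) : ∃ c₁ c₂, c₁ ≠ c₂ ∧
      S.state = Function.update (flipState η c₁) c₂ (-η) ∧ (∀ x, S.sign x = η) ∧
      ∀ v, IsEnd (D.constState η) c₁ v ↔ IsEnd (D.constState η) c₂ v := by
  classical
  obtain ⟨s, e⟩ := S
  rw [isLevel_mk_iff] at h
  obtain ⟨h1, h2⟩ := h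
  obtain ⟨c₁, c₂, hne, hc⟩ := Finset.card_eq_two.1
    (show (Finset.univ.filter fun c => s c ≠ η).card = 2 by exact_mod_cast h1)
  have hmem := fun c' => Finset.ext_iff.1 hc c'
  simp only [Finset.mem_filter, Finset.mem_univ, true_and, Finset.mem_insert,
    Finset.mem_singleton] at hmem
  have hs : s = Function.update (flipState η c₁) c₂ (-η) := by
    ext1 c'
    by_cases h2 : c' = c₂
    · subst h2
      rw [Function.update_self]
      exact units_eq_neg_of_ne ((hmem c').2 (Or.inr rfl))
    rw [Function.update_of_ne h2]
    by_cases h1 : c' = c₁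
    · subst h1
      rw [flipState_self]
      exact units_eq_neg_of_ne ((hmem c').2 (Or.inl rfl))
    · rw [flipState_of_ne η h1]
      exact not_not.1 (mt (hmem c').1 (by tauto))
  subst hs
  have h3 := numCircles_flipState hA c₁
  have hag := agreeOff_update c₂ (flipState η c₁) (-η)
  have h4 := hag.numCircles_le
  -- The first flip loses a circle and the second gains at most one, so `|s| ≤ |s_η|`, while twice
  -- the number of wrong signs is `|s| - |s_η|`.
  have h0 : (Finset.univ.filter fun x => e x ≠ η).card = 0 := by
    omega
  -- A second merge would make that difference equal to -2.
  have h5 : D.circleOf (flipState η c₁) (Sum.inl (c₂, 0)) =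
      D.circleOf (flipState η c₁) (Sum.inl (c₂, 2)) := by
    by_contra hcon
    have := hag.numCircles_of_merge (by
      rw [Function.update_self, flipState_of_ne η hne.symm]
      exact neg_unit_ne η) hcon
    rw [h0] at h2
    omega
  rw [Finset.card_eq_zero, Finset.filter_eq_empty_iff] at h0
  refine ⟨c₁, c₂, hne, rfl, fun x => not_not.1 (h0 (Finset.mem_univ x)), fun v => ?_⟩
  -- Flipping `c₁` put the two strands of `c₂` on one circle although adequacy keeps them apart in
  -- `s_η`; so both of their circles run through `c₁`.
  have h6 := ((agreeOff_update c₁ (D.constState η) (-η)).eq_or_through h5).resolve_left (hA c₂)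
  rw [through_iff, through_iff] at h6
  have h7 := hA c₂
  unfold IsEnd
  obtain ⟨h8 | h8, h9 | h9⟩ := h6
  · exact absurd (h8.trans h9.symm) h7
  · rw [h8, h9]
  · rw [h8, h9, or_comm]
  · exact absurd (h8.trans h9.symm) h7

/-! ### Incidence numbers and their signs. -/

/-- The sign `(-1)^t` in the incidence number. -/
def changeSign (s : D.KState) (c : Fin D.N) : ℤˣ :=
  (-1) ^ (Finset.univ.filter (fun c' => c < c' ∧ s c' = -1)).card

theorem changeSign_update_of_lt (s : D.KState) {c c' : Fin D.N} (hs : s c = 1) (h : c' < c) :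
    changeSign (Function.update s c (-1)) c' = -changeSign s c' := by
  have : (Finset.univ.filter fun d => c' < d ∧ Function.update s c (-1) d = -1) =
      insert c (Finset.univ.filter fun d => c' < d ∧ s d = -1) := by
    ext d
    by_cases hd : d = c
    · subst hd; simp [h]
    · simp [hd]
  unfold changeSign
  rw [this, Finset.card_insert_of_notMem (by simp [hs, h]), pow_succ]
  simp

theorem changeSign_update_of_le (s : D.KState) {c c' : Fin D.N} (m : ℤˣ) (h : c ≤ c') :
    changeSign (Function.update s c m) c' = changeSign s c' := by
  unfold changeSign
  congr 2
  ext d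
  by_cases hd : d = c
  · subst hd; simp [h.not_gt]
  · simp [hd]

/-- The two orders of changing two markers carry opposite signs. -/
theorem changeSign_mul_add (s : D.KState) {c₁ c₂ : Fin D.N} (hne : c₁ ≠ c₂) (h₁ : s c₁ = 1)
    (h₂ : s c₂ = 1) :
    (changeSign s c₁ : ℤ) * changeSign (Function.update s c₁ (-1)) c₂ +
      changeSign s c₂ * changeSign (Function.update s c₂ (-1)) c₁ = 0 := by
  rcases lt_or_gt_of_ne hne with h | h
  · rw [changeSign_update_of_le s _ h.le, changeSign_update_of_lt s h₂ h]
    push_cast; ring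
  · rw [changeSign_update_of_le s _ h.le, changeSign_update_of_lt s h₁ h]
    push_cast; ring

namespace EnhancedState

theorem incidence_eq_zero {S S' : D.EnhancedState} (h : ∀ c, ¬ S.Changes S' c) :
    S.incidence S' = 0 := by
  classical
  exact Finset.sum_eq_zero fun c _ => if_neg (h c)

-- The markers determine which crossing changes, so the sum collapses to the term of `c`, and only
-- the condition on circles away from `c` remains to be tested.
open Classical in
theorem incidence_eq {S S' : D.EnhancedState} {c : Fin D.N}
    (h' : S'.state = Function.update S.state c (-1)) (h : S.state c = 1)
    (ht : S'.tau = S.tau + 1) :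
    S.incidence S' = if ∀ x, ¬ Through S.state c x →
      S'.sign (D.circleOf S'.state x) = S.sign (D.circleOf S.state x) then
        (changeSign S.state c : ℤ) else 0 := by
  have key : S.Changes S' c ↔ ∀ x, ¬ Through S.state c x →
      S'.sign (D.circleOf S'.state x) = S.sign (D.circleOf S.state x) := by
    unfold Changes Through
    simp only [h, h', ht, true_and, and_true, not_exists, ne_eq]
  unfold incidence
  rw [Finset.sum_eq_single c]
  · simp only [key, changeSign]
    push_cast
    rfl
  · intro c' _ hc
    refine if_neg fun hch => ?_
    have h1 := congrFun (h'.symm.trans hch.2.1) c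
    rw [Function.update_self, Function.update_of_ne hc.symm, h] at h1
    exact absurd h1 (by decide)
  · simp

end EnhancedState

/-- `v` is the only circle with sign `-η`, so the condition says that `v` is not among the circles
missing `c`. -/
theorem forall_vertexGen_sign {η : ℤˣ} (v : D.Circle (D.constState η)) (c : Fin D.N) :
    (∀ x, ¬ Through (D.constState η) c x →
      (vertexGen η v).sign (D.circleOf (D.constState η) x) = η) ↔
      IsEnd (D.constState η) c v := by
  obtain ⟨y, rfl⟩ := circleOf_surjective _ v
  have hx : ∀ x, (vertexGen η (D.circleOf (D.constState η) y)).sign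
      (D.circleOf (D.constState η) x) = η ↔
        D.circleOf (D.constState η) x ≠ D.circleOf (D.constState η) y := by
    intro x
    unfold vertexGen
    simp only
    split_ifs with h
    · simp [h, neg_unit_ne η]
    · simp [h]
  simp only [hx]
  rw [IsEnd, ← through_iff]
  constructor
  · intro h
    by_contra hy
    exact h y hy rfl
  · intro hy x hx hxy
    exact hx ((through_congr hxy).2 hy)

/-- The incidence number of `S` and `S'`, taken in the direction in which `η` changes to `-η`. -/
noncomputable def directedIncidence (η : ℤˣ) (S S' : D.EnhancedState) : ℤ :=
  if η = 1 then S.incidence S' else S'.incidence S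

/-- The sign of the edge `c` in the boundary of a circle of `D_{s_η}`. -/
noncomputable def edgeSign (η : ℤˣ) (c : Fin D.N) : ℤˣ :=
  if η = 1 then changeSign (D.constState 1) c else changeSign (flipState (-1) c) c

/-- As `σ + 2τ` is fixed, flipping a positive marker lowers `σ` by two and so raises `τ` by one. -/
theorem tau_succ {j : ℤ} {S S' : D.EnhancedState} (h : IsLevel 1 j S) (h' : IsLevel 1 (j + 1) S') :
    S'.tau = S.tau + 1 := by
  obtain ⟨h1, h2⟩ := h
  obtain ⟨h3, h4⟩ := h'
  simp only [Units.val_one, one_mul] at *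
  omega

theorem tau_pred {j : ℤ} {S S' : D.EnhancedState} (h : IsLevel (-1) j S)
    (h' : IsLevel (-1) (j + 1) S') : S.tau = S'.tau + 1 := by
  obtain ⟨h1, h2⟩ := h
  obtain ⟨h3, h4⟩ := h'
  simp only [Units.val_one, Units.val_neg, neg_mul, one_mul] at *
  omega

-- This identifies the first differential with the signless incidence matrix up to one sign per row:
-- `edgeSign` does not depend on `v`. For `η = -1` the change starts at the edge state, which is why
-- its sign is computed there.
open Classical in
theorem directedIncidence_vertexGen_edgeGen {η : ℤˣ} (hA : IsAdequateState (D.constState η))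
    (v : D.Circle (D.constState η)) (c : Fin D.N) :
    directedIncidence η (vertexGen η v) (edgeGen η c) =
      if IsEnd (D.constState η) c v then (edgeSign η c : ℤ) else 0 := by
  have hv := isLevel_vertexGen η v
  have he := isLevel_edgeGen hA c
  rw [← forall_vertexGen_sign]
  unfold directedIncidence edgeSign
  rcases Int.units_eq_one_or η with rfl | rfl
  · simp only [if_true]
    rw [EnhancedState.incidence_eq (c := c) rfl rfl (tau_succ hv he)]
    refine if_congr (forall_congr' fun x => imp_congr_right fun _ => ?_) rfl rfl
    exact eq_comm
  · simp only [if_neg (show (-1 : ℤˣ) ≠ 1 by decide)]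
    rw [EnhancedState.incidence_eq (c := c) ?_ (by
      change flipState (-1) c c = 1
      rw [flipState_self]; rfl) (tau_pred hv he)]
    · refine if_congr (forall_congr' fun x => imp_congr ?_ ?_) rfl rfl
      · exact not_congr ((agreeOff_update c (D.constState (-1)) _).through_iff_through x).symm
      · exact Iff.rfl
    · change D.constState (-1) = Function.update (flipState (-1) c) c (-1)
      unfold flipState
      rw [Function.update_idem]
      exact (Function.update_eq_self c (D.constState (-1))).symm

/-- Two consecutive changes starting from `vertexGen η v` cancel. -/
theorem sum_directedIncidence_mul_eq_zero {η : ℤˣ} (hA : IsAdequateState (D.constState η))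
    (v : D.Circle (D.constState η)) {S : D.EnhancedState} (hS : IsLevel η 2 S) :
    ∑ c, directedIncidence η (edgeGen η c) S *
      directedIncidence η (vertexGen η v) (edgeGen η c) = 0 := by
  classical
  obtain ⟨c₁, c₂, hne, hst, hsign, hend⟩ := exists_parallel hA hS
  have hst' : S.state = Function.update (flipState η c₂) c₁ (-η) := by
    rw [hst, flipState, flipState, Function.update_comm hne.symm]
  have hst1 : S.state c₁ = -η := by rw [hst', Function.update_self]
  have hst2 : S.state c₂ = -η := by rw [hst, Function.update_self]
  simp only [directedIncidence_vertexGen_edgeGen hA]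
  -- `S` has marker `η` at `c` but `edgeGen η c` has `-η`, and no change in the direction from `η`
  -- to `-η` can undo this.
  have hoff : ∀ c, c ≠ c₁ ∧ c ≠ c₂ → directedIncidence η (edgeGen η c) S = 0 := by
    rintro c ⟨hc1, hc2⟩
    unfold directedIncidence
    have h0 : S.state c = η := by rw [hst, Function.update_of_ne hc2, flipState_of_ne η hc1]
    split_ifs with h
    · subst h
      refine EnhancedState.incidence_eq_zero fun d hd => ?_
      have h1 := congrFun hd.2.1 c
      change S.state c = Function.update (flipState 1 c) d (-1) c at h1
      by_cases hcd : c = d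
      · subst hcd; rw [Function.update_self, h0] at h1; exact absurd h1 (by decide)
      · rw [Function.update_of_ne hcd, h0, flipState_self] at h1; exact absurd h1 (by decide)
    · obtain rfl := (Int.units_eq_one_or η).resolve_left h
      refine EnhancedState.incidence_eq_zero fun d hd => ?_
      have h1 := congrFun hd.2.1 c
      change flipState (-1) c c = Function.update S.state d (-1) c at h1
      rw [flipState_self] at h1
      by_cases hcd : c = d
      · subst hcd; rw [Function.update_self] at h1; exact absurd h1 (by decide)
      · rw [Function.update_of_ne hcd, h0] at h1; exact absurd h1 (by decide)
  -- All circle signs on both sides are `η`, so the condition on circles away from `d` is automatic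
  -- and only the sign remains.
  have hval : ∀ c d, c ≠ d → S.state = Function.update (flipState η c) d (-η) →
      directedIncidence η (edgeGen η c) S =
        if η = 1 then (changeSign (flipState 1 c) d : ℤ) else changeSign S.state d := by
    intro c d hcd hs
    have he := isLevel_edgeGen hA c
    unfold directedIncidence
    rcases Int.units_eq_one_or η with rfl | rfl
    · simp only [if_true]
      rw [EnhancedState.incidence_eq (c := d) hs (flipState_of_ne 1 hcd.symm) (tau_succ he hS),
        if_pos]
      · rfl
      · intro x _; exact hsign _
    · rw [if_neg (by decide), if_neg (by decide)]
      rw [EnhancedState.incidence_eq (c := d) ?_ (by rw [hs, Function.update_self]; rfl)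
        (tau_pred he hS), if_pos]
      · intro x _; exact (hsign _).symm
      · change flipState (-1) c = _
        rw [hs, Function.update_idem]
        exact (update_flipState_of_ne (-1) hcd.symm).symm
  rw [Fintype.sum_eq_add c₁ c₂ hne (fun c hc => by rw [hoff c hc, zero_mul]),
    hval c₁ c₂ hne hst, hval c₂ c₁ hne.symm hst']
  -- `c₁` and `c₂` have the same ends: either both routes from `v` to `S` exist and their signs
  -- cancel, or neither does.
  by_cases hv : IsEnd (D.constState η) c₁ v
  · rw [if_pos hv, if_pos ((hend v).1 hv)]
    unfold edgeSign
    rcases Int.units_eq_one_or η with rfl | rfl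
    · simp only [if_true]
      have := changeSign_mul_add (D.constState 1) hne rfl rfl
      rw [← this]
      change _ = _ * ((changeSign (flipState 1 c₁) c₂ : ℤˣ) : ℤ) +
        _ * ((changeSign (flipState 1 c₂) c₁ : ℤˣ) : ℤ)
      ring
    · simp only [if_neg (show (-1 : ℤˣ) ≠ 1 by decide)]
      have := changeSign_mul_add S.state hne hst1 hst2
      have e1 : Function.update S.state c₁ (-1) = flipState (-1) c₂ := by
        rw [hst', Function.update_idem, update_flipState_of_ne (-1) hne]
      have e2 : Function.update S.state c₂ (-1) = flipState (-1) c₁ := by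
        rw [hst, Function.update_idem, update_flipState_of_ne (-1) hne.symm]
      rw [e1, e2] at this
      rw [← this]; ring
  · rw [if_neg hv, if_neg (mt (hend v).2 hv)]; ring

end LinkDiagram

/-! ### From the chain complex to the state graph. -/

/-- The cokernel of a map which is the signless incidence map up to reindexing and signs. -/
theorem nonempty_coker_equiv_signlessIncidence {V E V' E' : Type*} (eV : V ≃ V') (eE : E ≃ E')
    (w : E → ℤˣ) (l r : E → V) (d : (V' → ℤ) →ₗ[ℤ] (E' → ℤ))
    (h : ∀ f e, d f (eE e) = w e * (f (eV (l e)) + f (eV (r e)))) :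
    Nonempty (((E' → ℤ) ⧸ LinearMap.range d) ≃ₗ[ℤ]
      ((E → ℤ) ⧸ LinearMap.range (signlessIncidence l r))) := by
  have hsq : ∀ e, (w e : ℤ) * w e = 1 := fun e => by
    rw [← Units.val_mul, Int.units_mul_self, Units.val_one]
  let φ : (E' → ℤ) ≃ₗ[ℤ] (E → ℤ) :=
    { toFun := fun g e => w e * g (eE e)
      invFun := fun g e => w (eE.symm e) * g (eE.symm e)
      map_add' := fun g g' => by ext e; simp [mul_add]
      map_smul' := fun a g => by ext e; simp [mul_left_comm]
      left_inv := fun g => by ext e; simp [← mul_assoc, hsq]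
      right_inv := fun g => by ext e; simp [← mul_assoc, hsq] }
  have hφ : ∀ f, φ (d f) = signlessIncidence l r (fun v => f (eV v)) := fun f => by
    ext e
    change w e * d f (eE e) = f (eV (l e)) + f (eV (r e))
    rw [h, ← mul_assoc, hsq, one_mul]
  refine ⟨Submodule.Quotient.equiv _ _ φ ?_⟩
  ext x
  constructor
  · rintro ⟨_, ⟨f, rfl⟩, rfl⟩
    exact ⟨_, (hφ f).symm⟩
  · rintro ⟨f, rfl⟩
    refine ⟨_, ⟨fun v => f (eV.symm v), rfl⟩, ?_⟩
    refine (hφ _).trans ?_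
    simp

namespace Graph.ListsEnds

variable {α β E : Type*} {G : Graph α β} {l r : E → G.vertexSet} (hlr : G.ListsEnds l r)
  [Finite G.vertexSet]
include hlr

theorem nonempty_torsion_coker_equiv_fin :
    Nonempty (AddCommGroup.torsion ((E → ℤ) ⧸ LinearMap.range (signlessIncidence l r)) ≃+
      (Fin (Nat.card {C : G.Component // ¬ C.IsBipartite}) → ZMod 2)) := by
  have : Finite G.Component := Finite.of_surjective _ componentOf_surjective
  obtain ⟨e⟩ := hlr.nonempty_torsion_coker_equiv
  exact ⟨e.trans (LinearEquiv.funCongrLeft (ZMod 2) (ZMod 2)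
    (Finite.equivFin {C : G.Component // ¬ C.IsBipartite}).symm).toAddEquiv⟩

theorem nonempty_coker_equiv [Finite E] :
    Nonempty (((E → ℤ) ⧸ LinearMap.range (signlessIncidence l r)) ≃+
      (Fin (Nat.card {C : G.Component // ¬ C.IsBipartite}) → ZMod 2) ×
        (Fin (Module.finrank ℤ ((E → ℤ) ⧸ LinearMap.range (signlessIncidence l r))) → ℤ)) := by
  obtain ⟨e⟩ := AddCommGroup.nonempty_equiv_torsion_prod
    ((E → ℤ) ⧸ LinearMap.range (signlessIncidence l r))
  obtain ⟨t⟩ := hlr.nonempty_torsion_coker_equiv_fin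
  exact ⟨e.trans (t.prodCongr (AddEquiv.refl _))⟩

end Graph.ListsEnds

theorem Graph.lt_of_lt_cycleGirth {α β : Type*} {G : Graph α β} {n m : ℕ} (h : m < G.cycleGirth)
    (hn : G.HasCycleOfLength n) : m < n := by
  have : G.cycleGirth ≤ n := iInf₂_le n hn
  exact_mod_cast h.trans_le this

namespace LinkDiagram

variable {D : LinkDiagram}

theorem isAdequateState_of_loopless {s : D.KState} (h : (D.stateGraph s).Loopless) :
    IsAdequateState s := fun c hc =>
  h.not_isLoopAt c (D.circleOf s (Sum.inl (c, 0))) (Or.inl ⟨rfl, hc⟩)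

theorem isAdequateState_of_cycleGirth {s : D.KState} (h : 2 < (D.stateGraph s).cycleGirth) :
    IsAdequateState s := by
  intro c hc
  have : (D.stateGraph s).HasCycleOfLength 1 :=
    ⟨one_pos, fun _ => D.circleOf s (Sum.inl (c, 0)), fun _ => c,
      Function.injective_of_subsingleton _, Function.injective_of_subsingleton _,
      fun _ => Or.inl ⟨rfl, hc⟩⟩
  have := Graph.lt_of_lt_cycleGirth (m := 2) h this
  omega

/-- Two crossings joining the same pair of circles form a cycle of length two. -/
theorem not_parallel_of_cycleGirth {s : D.KState} (h : 2 < (D.stateGraph s).cycleGirth)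
    {c₁ c₂ : Fin D.N} (hne : c₁ ≠ c₂) : ¬ ∀ v, IsEnd s c₁ v ↔ IsEnd s c₂ v := by
  intro hend
  have hA := isAdequateState_of_cycleGirth h
  have h0 := (hend _).1 (Or.inl rfl)
  have h2 := (hend _).1 (Or.inr rfl)
  have hlink₂ : (D.stateGraph s).IsLink c₂ (D.circleOf s (Sum.inl (c₁, 2)))
      (D.circleOf s (Sum.inl (c₁, 0))) := by
    have := hA c₁
    rcases h0 with h0 | h0 <;> rcases h2 with h2 | h2
    · exact absurd (h0.trans h2.symm) this
    · exact Or.inr ⟨h2, h0⟩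
    · exact Or.inl ⟨h2, h0⟩
    · exact absurd (h0.trans h2.symm) this
  have : (D.stateGraph s).HasCycleOfLength 2 := by
    refine ⟨two_pos, (![D.circleOf s (Sum.inl (c₁, 0)), D.circleOf s (Sum.inl (c₁, 2))] :
      Fin 2 → D.Circle s), (![c₁, c₂] : Fin 2 → Fin D.N), ?_, ?_, ?_⟩
    · intro i j hij
      change Fin 2 at i j
      fin_cases i <;> fin_cases j
      · rfl
      · exact absurd hij (hA c₁)
      · exact absurd hij.symm (hA c₁)
      · rfl
    · intro i j hij
      change Fin 2 at i j
      fin_cases i <;> fin_cases j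
      · rfl
      · exact absurd hij hne
      · exact absurd hij.symm hne
      · rfl
    · intro i
      change Fin 2 at i
      fin_cases i
      · exact Or.inl ⟨rfl, rfl⟩
      · exact hlink₂
  have := Graph.lt_of_lt_cycleGirth (m := 2) h this
  omega

/-- The circle at the end `(c, i)`, as a vertex of the state graph. -/
def endVertex (s : D.KState) (i : Fin 4) (c : Fin D.N) : (D.stateGraph s).vertexSet :=
  ⟨D.circleOf s (Sum.inl (c, i)), trivial⟩

theorem listsEnds (s : D.KState) :
    (D.stateGraph s).ListsEnds (endVertex s 0) (endVertex s 2) := by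
  rintro ⟨x, hx⟩ ⟨y, hy⟩
  refine exists_congr fun c => ?_
  simp only [endVertex, Subtype.ext_iff]
  constructor
  · rintro (⟨rfl, rfl⟩ | ⟨rfl, rfl⟩) <;> simp
  · rintro (⟨h₁, h₂⟩ | ⟨h₁, h₂⟩)
    · exact Or.inl ⟨h₁.symm, h₂.symm⟩
    · exact Or.inr ⟨h₂.symm, h₁.symm⟩

instance (s : D.KState) : Finite (D.stateGraph s).vertexSet :=
  inferInstanceAs (Finite {_x : D.Circle s // True})

theorem Gen.isLevel {η : ℤˣ} {j a b : ℤ} (ha : a = η * (D.N - 2 * j))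
    (hb : b = η * (D.N + 2 * D.numCircles (D.constState η) - 4)) (S : D.Gen a b) :
    IsLevel η j S.1 :=
  ⟨S.2.1.trans ha, S.2.2.trans hb⟩

section Generators

variable {η : ℤˣ} {a₀ a₁ a₂ b : ℤ} (h₀ : a₀ = η * (D.N - 2 * 0)) (h₁ : a₁ = η * (D.N - 2 * 1))
  (h₂ : a₂ = η * (D.N - 2 * 2))
  (hb : b = η * (D.N + 2 * D.numCircles (D.constState η) - 4))
  (hA : IsAdequateState (D.constState η))

/-- The circles of `D_{s_η}` index the generators in the extremal homological degree. -/
noncomputable def vertexEquiv : (D.stateGraph (D.constState η)).vertexSet ≃ D.Gen a₀ b :=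
  Equiv.ofBijective
    (fun v => ⟨vertexGen η v.1, (isLevel_vertexGen η v.1).1.trans h₀.symm,
      (isLevel_vertexGen η v.1).2.trans hb.symm⟩)
    ⟨fun v w h => Subtype.ext (vertexGen_injective η (congrArg Subtype.val h)), fun S => by
      obtain ⟨v, hv⟩ := exists_vertexGen (Gen.isLevel h₀ hb S)
      exact ⟨⟨v, trivial⟩, Subtype.ext hv⟩⟩

/-- The crossings index the generators in the next homological degree. -/
noncomputable def edgeEquiv : Fin D.N ≃ D.Gen a₁ b :=
  Equiv.ofBijective
    (fun c => ⟨edgeGen η c, (isLevel_edgeGen hA c).1.trans h₁.symm,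
      (isLevel_edgeGen hA c).2.trans hb.symm⟩)
    ⟨fun v w h => edgeGen_injective η (congrArg Subtype.val h), fun S => by
      obtain ⟨v, hv⟩ := exists_edgeGen hA (Gen.isLevel h₁ hb S)
      exact ⟨v, Subtype.ext hv⟩⟩

variable {A : Matrix (D.Gen a₁ b) (D.Gen a₀ b) ℤ}
  (hM : ∀ e v, A e v = directedIncidence η v.1 e.1)
include h₀ h₁ hb hA hM

/-- The row of `c` is supported on its two end circles; adequacy makes them distinct, so exactly two
terms survive. -/
theorem mulVecLin_edgeEquiv (f : D.Gen a₀ b → ℤ) (c : Fin D.N) :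
    A.mulVecLin f (edgeEquiv h₁ hb hA c) =
      edgeSign η c * (f (vertexEquiv h₀ hb (endVertex _ 0 c)) +
        f (vertexEquiv h₀ hb (endVertex _ 2 c))) := by
  classical
  have := Fintype.ofFinite (D.stateGraph (D.constState η)).vertexSet
  have hent : ∀ v, A (edgeEquiv h₁ hb hA c) (vertexEquiv h₀ hb v) =
      if v = endVertex _ 0 c ∨ v = endVertex _ 2 c then (edgeSign η c : ℤ) else 0 := fun v => by
    refine (hM _ _).trans ((directedIncidence_vertexGen_edgeGen hA v.1 c).trans ?_)
    refine if_congr ?_ rfl rfl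
    simp only [IsEnd, endVertex, Subtype.ext_iff]
  have hne : endVertex (D.constState η) 0 c ≠ endVertex (D.constState η) 2 c := fun h =>
    hA c (congrArg Subtype.val h)
  rw [Matrix.mulVecLin_apply, Matrix.mulVec, dotProduct,
    ← (vertexEquiv h₀ hb).sum_comp]
  simp only [hent]
  rw [Fintype.sum_eq_add _ _ hne (fun v hv => by rw [if_neg (by tauto), zero_mul])]
  simp only [true_or, or_true, if_true]
  ring

theorem nonempty_coker_equiv_signlessIncidence :
    Nonempty (((D.Gen a₁ b → ℤ) ⧸ LinearMap.range A.mulVecLin) ≃ₗ[ℤ]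
      ((Fin D.N → ℤ) ⧸ LinearMap.range
        (signlessIncidence (endVertex (D.constState η) 0) (endVertex (D.constState η) 2)))) :=
  _root_.nonempty_coker_equiv_signlessIncidence (vertexEquiv h₀ hb) (edgeEquiv h₁ hb hA)
    (edgeSign η) _ _ _ (mulVecLin_edgeEquiv h₀ h₁ hb hA hM)

variable {B : Matrix (D.Gen a₂ b) (D.Gen a₁ b) ℤ}
  (hM' : ∀ f e, B f e = directedIncidence η e.1 f.1)

include h₂ hM' in
theorem mulVecLin_comp_eq_zero : B.mulVecLin ∘ₗ A.mulVecLin = 0 := by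
  rw [← Matrix.mulVecLin_mul]
  have : B * A = 0 := by
    ext S v
    obtain ⟨v, rfl⟩ := (vertexEquiv h₀ hb).surjective v
    rw [Matrix.mul_apply, ← (edgeEquiv h₁ hb hA).sum_comp]
    simp only [hM, hM']
    exact sum_directedIncidence_mul_eq_zero hA v.1 (Gen.isLevel h₂ hb S)
  rw [this, Matrix.mulVecLin_zero]

include h₂ hM' in
/-- The torsion of the homology in the second extremal degree of an adequate diagram. -/
theorem exists_torsion_equiv :
    ∃ k : ℕ, (k : ℤ) = (D.stateGraph (D.constState η)).numComponents -
        (D.stateGraph (D.constState η)).numBipartiteComponents ∧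
      Nonempty (AddCommGroup.torsion (LinearMap.ker B.mulVecLin ⧸
        (LinearMap.range A.mulVecLin).submoduleOf (LinearMap.ker B.mulVecLin)) ≃+
          (Fin k → ZMod 2)) := by
  refine ⟨_, Graph.natCard_not_isBipartite, ?_⟩
  obtain ⟨e₁⟩ := nonempty_torsion_homology_equiv A.mulVecLin B.mulVecLin
    (mulVecLin_comp_eq_zero h₀ h₁ h₂ hb hA hM hM')
  obtain ⟨e₂⟩ := nonempty_coker_equiv_signlessIncidence h₀ h₁ hb hA hM
  obtain ⟨e₃⟩ := AddCommGroup.nonempty_torsion_equiv e₂.toLinearMap.toAddMonoidHom e₂.injective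
    fun y _ => e₂.surjective y
  obtain ⟨e₄⟩ := (listsEnds (D.constState η)).nonempty_torsion_coker_equiv_fin
  exact ⟨e₁.trans (e₃.trans e₄)⟩

omit hA in
include h₂ in
/-- The homology in the second extremal degree of a strongly adequate diagram. -/
theorem exists_homology_equiv (hG : 2 < (D.stateGraph (D.constState η)).cycleGirth) :
    ∃ k r : ℕ, (k : ℤ) = (D.stateGraph (D.constState η)).numComponents -
        (D.stateGraph (D.constState η)).numBipartiteComponents ∧
      (r : ℤ) = (D.stateGraph (D.constState η)).cyclomaticNumber - k ∧
      Nonempty ((LinearMap.ker B.mulVecLin ⧸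
        (LinearMap.range A.mulVecLin).submoduleOf (LinearMap.ker B.mulVecLin)) ≃+
          (Fin k → ZMod 2) × (Fin r → ℤ)) := by
  have hA := isAdequateState_of_cycleGirth hG
  -- A generator at level 2 would give parallel edges, excluded by the girth; so the outgoing
  -- differential has target zero.
  have : IsEmpty (D.Gen a₂ b) := ⟨fun S => by
    obtain ⟨c₁, c₂, hne, -, -, hend⟩ := exists_parallel hA (Gen.isLevel h₂ hb S)
    exact not_parallel_of_cycleGirth hG hne hend⟩
  refine ⟨_, Module.finrank ℤ ((Fin D.N → ℤ) ⧸ LinearMap.range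
    (signlessIncidence (endVertex (D.constState η) 0) (endVertex (D.constState η) 2))),
    Graph.natCard_not_isBipartite, ?_, ?_⟩
  · have h3 := (listsEnds (D.constState η)).finrank_coker
    have h4 : (D.stateGraph (D.constState η)).edgeSet.ncard = Nat.card (Fin D.N) :=
      Set.ncard_univ _
    have h5 : (D.stateGraph (D.constState η)).vertexSet.ncard =
      Nat.card (D.stateGraph (D.constState η)).vertexSet := rfl
    rw [Graph.natCard_not_isBipartite, Graph.cyclomaticNumber]
    omega
  · obtain ⟨e₁⟩ := nonempty_homology_equiv A.mulVecLin B.mulVecLin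
    obtain ⟨e₂⟩ := nonempty_coker_equiv_signlessIncidence h₀ h₁ hb hA hM
    obtain ⟨e₃⟩ := (listsEnds (D.constState η)).nonempty_coker_equiv
    exact ⟨e₁.trans (e₂.toAddEquiv.trans e₃)⟩

end Generators

end LinkDiagram

theorem corollary3p7 (D : LinkDiagram) :
    (D.IsPlusAdequate →
      ∃ k : ℕ, (k : ℤ) = D.plusGraph.numComponents - D.plusGraph.numBipartiteComponents ∧
        Nonempty (AddCommGroup.torsion
            (D.Homology (D.N - 2) (D.N + 2 * D.numCircles D.plusState - 4)) ≃+
          (Fin k → ZMod 2))) ∧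
    (D.IsStronglyPlusAdequate →
      ∃ k r : ℕ, (k : ℤ) = D.plusGraph.numComponents - D.plusGraph.numBipartiteComponents ∧
        (r : ℤ) = D.plusGraph.cyclomaticNumber - k ∧
        Nonempty (D.Homology (D.N - 2) (D.N + 2 * D.numCircles D.plusState - 4) ≃+
          (Fin k → ZMod 2) × (Fin r → ℤ))) ∧
    (D.IsMinusAdequate →
      ∃ k : ℕ, (k : ℤ) = D.minusGraph.numComponents - D.minusGraph.numBipartiteComponents ∧
        Nonempty (AddCommGroup.torsion
            (D.Cohomology (-D.N + 2) (-D.N - 2 * D.numCircles D.minusState + 4)) ≃+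
          (Fin k → ZMod 2))) ∧
    (D.IsStronglyMinusAdequate →
      ∃ k r : ℕ, (k : ℤ) = D.minusGraph.numComponents - D.minusGraph.numBipartiteComponents ∧
        (r : ℤ) = D.minusGraph.cyclomaticNumber - k ∧
        Nonempty (D.Cohomology (-D.N + 2) (-D.N - 2 * D.numCircles D.minusState + 4) ≃+
          (Fin k → ZMod 2) × (Fin r → ℤ))) := by
  have hp : ∀ n : ℤ, (D.N + 2 * n - 4 : ℤ) = ((1 : ℤˣ) : ℤ) * (D.N + 2 * n - 4) := fun n => by
    simp
  have hm : ∀ n : ℤ, (-D.N - 2 * n + 4 : ℤ) = ((-1 : ℤˣ) : ℤ) * (D.N + 2 * n - 4) := fun n => by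
    push_cast; ring
  -- Cohomology uses the transposed matrices, whose entries are the incidence numbers directed away
  -- from `s₋`.
  have hdir : ∀ S S' : D.EnhancedState,
      S.incidence S' = LinkDiagram.directedIncidence (-1) S' S := fun S S' =>
    (if_neg (by decide)).symm
  refine ⟨fun h => ?_, fun h => ?_, fun h => ?_, fun h => ?_⟩
  -- The homological degrees `N`, `N - 2`, `N - 4` are the levels 0, 1, 2 for `η = 1`; for `η = -1`
  -- their negatives play this role.
  · exact LinkDiagram.exists_torsion_equiv (η := 1) (by push_cast; ring) (by push_cast; ring)
      (by push_cast; ring) (hp _) (LinkDiagram.isAdequateState_of_loopless h)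
      (A := D.incMatrix _ _ _) (fun _ _ => rfl) (B := D.incMatrix _ _ _) (fun _ _ => rfl)
  · exact LinkDiagram.exists_homology_equiv (η := 1) (by push_cast; ring) (by push_cast; ring)
      (by push_cast; ring) (hp _) (A := D.incMatrix _ _ _) (fun _ _ => rfl)
      (B := D.incMatrix _ _ _) h
  · exact LinkDiagram.exists_torsion_equiv (η := -1) (by push_cast; ring) (by push_cast; ring)
      (by push_cast; ring) (hm _) (LinkDiagram.isAdequateState_of_loopless h)
      (A := (D.incMatrix _ _ _).transpose) (fun _ _ => hdir _ _)
      (B := (D.incMatrix _ _ _).transpose) (fun _ _ => hdir _ _)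
  · exact LinkDiagram.exists_homology_equiv (η := -1) (by push_cast; ring) (by push_cast; ring)
      (by push_cast; ring) (hm _) (A := (D.incMatrix _ _ _).transpose) (fun _ _ => hdir _ _)
      (B := (D.incMatrix _ _ _).transpose) h
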